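/- Let $\mathbb{K}\in\{\mathbb{R},\mathbb{C}\}$, let the variables $\mathbf{t}=(t_1,t_3,t_5,\ldots)$ be real or complex (in the complex case $\mathbb K=\mathbb C$), and let $\Omega$ be a set of such $\mathbf t$ that is open in each finite collection of the variables. Functions on $\Omega$ are smooth (in each finite collection of the variables), and subscripts $t_n$ denote partial derivatives. **Odd Riccati hierarchy.** For constant $N\times N$ matrices $R,Q,S,L$ over $\mathbb{K}$, put $H=\begin{pmatrix}R&Q\\S&L\end{pmatrix}$ and $H^n=\begin{pmatrix}R_n&Q_n\\S_n&L_n\end{pmatrix}$. An $N\times N$ matrix function $\Phi$ solves the odd Riccati hierarchy if $$\Phi_{t_n}=S_n+L_n\Phi-\Phi R_n-\Phi Q_n\Phi,\qquad n=1,3,5,\ldots$$ Put $$\Theta=\tfrac12\Big(L\Phi+\Phi R-\int(\Phi Q\Phi_{t_1}-\Phi_{t_1}Q\Phi)\,dt_1\Big),$$ where $\int\cdots dt_1$ is a smooth $t_1$-antiderivative. **Matrix CKP hierarchy.** Let $\partial=\partial/\partial t_1$. Two $m\times m$ matrix functions $\phi,\theta$ solve the $m\times m$ matrix odd KP hierarchy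 if there is a formal pseudodifferential operator $\mathcal{L}=\partial+u_2\partial^{-1}+u_3\partial^{-2}+\cdots$ with smooth $m\times m$ matrix coefficients such that $$\mathcal{L}_{t_n}=[(\mathcal{L}^n)_{\ge0},\mathcal{L}]\quad(n=1,3,5,\ldots),\qquad u_2=\phi_{t_1},\qquad u_3=\theta_{t_1}-\tfrac12\phi_{t_1t_1},$$ and $\phi$ is a potential for all the flows, i.e. $\phi_{t_n}$ is the coefficient of $\partial^{-1}$ in $\mathcal{L}^n$ for all odd $n$. Here $(\;)_{\ge0}$ is the projection to the differential operator part. They solve the $m\times m$ matrix CKP hierarchy if, moreover, $\mathcal{L}$ can be chosen such that $\mathcal{L}+\mathcal{L}^*=0$, where $\big(\sum_i a_i\partial^i\big)^*=\sum_i(-\partial)^i a_i^{\intercal}$, and $$\phi^\intercal=\phi,\qquad\theta^\intercal=-\theta .$$ **Proposition.** Let $\Phi$ be an $N\times N$ matrix solution on $\Omega$ of the odd Riccati hierarchy with $$R=-L^\intercal,\qquad S=S^\intercal,\qquad Q=VV^\intercal,$$ where $V$ is a constant $N\times m$ matrix. Suppose that $\Phi^\intercal=\Phi$ and that the constants of integration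 in $\Theta$ are skew-symmetric, i.e. on each connected component of the intersection of $\Omega$ with a line parallel to the $t_1$-axis the integral is skew-symmetric at some point (for instance zero at a base point). Then $$\phi=V^\intercal\Phi V\qquad\text{and}\qquad\theta=V^\intercal\Theta V$$ solve the $m\times m$ matrix CKP hierarchy on $\Omega$; in particular $\theta^\intercal=-\theta$. -/

import Mathlib

open scoped Matrix ContDiff

noncomputable section

/-- Points `(t₁, t₃, t₅, …)`: the entry with index `k` is the variable `t_{2k+1}`. -/
abbrev OddTimes (𝕜 : Type*) := ℕ → 𝕜

namespace OddTimes

variable {𝕜 𝕂 : Type*} [RCLike 𝕜] [RCLike 𝕂] [NormedAlgebra 𝕜 𝕂] {ι κ : Type*}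

/-- The point whose first `n` odd variables are `s` and whose other variables are those of `t`. -/
def setFirst (t : OddTimes 𝕜) (n : ℕ) (s : Fin n → 𝕜) : OddTimes 𝕜 :=
  fun k => if h : k < n then s ⟨k, h⟩ else t k

/-- `Ω` is open in each finite collection of the variables. Only finitely many variables are
moved at a time, so that a domain of convergence for `∑ t_{2k+1} H^{2k+1}` is allowed. -/
def IsDomain (Ω : Set (OddTimes 𝕜)) : Prop :=
  ∀ (t : OddTimes 𝕜) (n : ℕ), IsOpen {s : Fin n → 𝕜 | t.setFirst n s ∈ Ω}

/-- A matrix-valued function is smooth on `Ω` if each entry is `C^∞` at every point of `Ω`, jointly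
in any finite collection of the variables (the remaining variables being fixed). -/
def SmoothOn (Ω : Set (OddTimes 𝕜)) (f : OddTimes 𝕜 → Matrix ι κ 𝕂) : Prop :=
  ∀ t ∈ Ω, ∀ (n : ℕ) (i : ι) (j : κ),
    ContDiffAt 𝕜 ∞ (fun s : Fin n → 𝕜 => f (t.setFirst n s) i j) (fun k => t k)

/-- The (entrywise) partial derivative of a matrix-valued function with respect to `t_{2k+1}`. -/
def pd (k : ℕ) (f : OddTimes 𝕜 → Matrix ι κ 𝕂) : OddTimes 𝕜 → Matrix ι κ 𝕂 :=
  fun t => Matrix.of fun i j => deriv (fun s : 𝕜 => f (Function.update t k s) i j) (t k)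

end OddTimes

/-! Formal pseudodifferential operators `∑ aᵢ ∂ⁱ` (`i` bounded above) over a ring `A` with
derivation `δ`, written as the function `i ↦ aᵢ`. All sums below are finite for coefficient
functions that vanish for all large `i`. -/

namespace PsiDO

variable {A : Type*} [Ring A]

/-- The product determined by `∂ⁱ a = ∑ₖ (i choose k) δᵏ(a) ∂^{i-k}`, for all integers `i`. -/
def mul (δ : A → A) (P Q : ℤ → A) : ℤ → A :=
  fun n => ∑ᶠ p : ℤ × ℕ, (Ring.choose p.1 p.2 : ℤ) • (P p.1 * δ^[p.2] (Q (n - p.1 + p.2)))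

/-- The identity operator. -/
def one : ℤ → A := fun i => if i = 0 then 1 else 0

/-- Powers of a pseudodifferential operator. -/
def pow (δ : A → A) (P : ℤ → A) : ℕ → ℤ → A
  | 0 => one
  | n + 1 => mul δ P (pow δ P n)

/-- The commutator of two pseudodifferential operators. -/
def comm (δ : A → A) (P Q : ℤ → A) : ℤ → A := fun n => mul δ P Q n - mul δ Q P n

/-- The projection to the differential operator part. -/
def nonneg (P : ℤ → A) : ℤ → A := fun i => if 0 ≤ i then P i else 0

/-- The adjoint `(∑ aᵢ ∂ⁱ)^* = ∑ (-∂)ⁱ τ(aᵢ)` with respect to an involution `τ` of `A`. -/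
def adjoint (δ τ : A → A) (P : ℤ → A) : ℤ → A :=
  fun n => ∑ᶠ k : ℕ,
    (((n + k).negOnePow : ℤ) * (Ring.choose (n + k) k : ℤ)) • δ^[k] (τ (P (n + k)))

/-- The operator `∂ + u₂ ∂⁻¹ + u₃ ∂⁻² + …`. -/
def lax (u : ℕ → A) : ℤ → A :=
  fun i => if i = 1 then 1 else if i < 0 then u (1 - i).toNat else 0

end PsiDO

section Hierarchies

variable {𝕜 𝕂 : Type*} [RCLike 𝕜] [RCLike 𝕂] [NormedAlgebra 𝕜 𝕂]

/-- `Φ` is a (smooth) solution on `Ω` of the odd Riccati hierarchy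
`Φ_{t_n} = Sₙ + Lₙ Φ - Φ Rₙ - Φ Qₙ Φ`, `n = 1, 3, 5, …`, where `Rₙ, Qₙ, Sₙ, Lₙ` are the blocks of
the `n`-th power of `H = (R Q; S L)`. -/
def SolvesOddRiccati {M N : ℕ} (Ω : Set (OddTimes 𝕜))
    (R : Matrix (Fin N) (Fin N) 𝕂) (Q : Matrix (Fin N) (Fin M) 𝕂)
    (S : Matrix (Fin M) (Fin N) 𝕂) (L : Matrix (Fin M) (Fin M) 𝕂)
    (Φ : OddTimes 𝕜 → Matrix (Fin M) (Fin N) 𝕂) : Prop :=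
  OddTimes.SmoothOn Ω Φ ∧
  ∀ k : ℕ, ∀ t ∈ Ω,
    let Hn := Matrix.fromBlocks R Q S L ^ (2 * k + 1)
    OddTimes.pd k Φ t =
      Hn.toBlocks₂₁ + Hn.toBlocks₂₂ * Φ t - Φ t * Hn.toBlocks₁₁ - Φ t * Hn.toBlocks₁₂ * Φ t

/-- `J` is a `t₁`-integral `∫ (Φ Q Φ_{t₁} - Φ_{t₁} Q Φ) dt₁` on `Ω`. -/
def IsCommutatorIntegral {M N : ℕ} (Ω : Set (OddTimes 𝕜)) (Q : Matrix (Fin N) (Fin M) 𝕂)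
    (Φ J : OddTimes 𝕜 → Matrix (Fin M) (Fin N) 𝕂) : Prop :=
  OddTimes.SmoothOn Ω J ∧
  ∀ t ∈ Ω, OddTimes.pd 0 J t = Φ t * Q * OddTimes.pd 0 Φ t - OddTimes.pd 0 Φ t * Q * Φ t

/-- The constants of integration (with respect to `t₁`) of `J` are skew-symmetric: on each connected
component of each line parallel to the `t₁`-axis in `Ω`, `J` is skew-symmetric at some point. This
holds in particular if `J` is the integral from a base point, where `J` vanishes. -/
def HasSkewConstants {N : ℕ} (Ω : Set (OddTimes 𝕜))
    (J : OddTimes 𝕜 → Matrix (Fin N) (Fin N) 𝕂) : Prop :=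
  ∀ t ∈ Ω, ∃ s ∈ connectedComponentIn {s : 𝕜 | Function.update t 0 s ∈ Ω} (t 0),
    (J (Function.update t 0 s))ᵀ = -J (Function.update t 0 s)

/-- `Θ = ½ (L Φ + Φ R - J)`, where `J = ∫ (Φ Q Φ_{t₁} - Φ_{t₁} Q Φ) dt₁`. -/
def riccatiTheta {M N : ℕ} (R : Matrix (Fin N) (Fin N) 𝕂) (L : Matrix (Fin M) (Fin M) 𝕂)
    (Φ J : OddTimes 𝕜 → Matrix (Fin M) (Fin N) 𝕂) : OddTimes 𝕜 → Matrix (Fin M) (Fin N) 𝕂 :=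
  fun t => (1 / 2 : 𝕂) • (L * Φ t + Φ t * R - J t)

/-- The functions `φ, θ` solve the `m × m` matrix odd KP hierarchy on `Ω` with Lax operator
`L = ∂ + u₂ ∂⁻¹ + u₃ ∂⁻² + …`: one has `L_{t_n} = [(Lⁿ)_{≥0}, L]` for all odd `n`,
`u₂ = φ_{t₁}` and `u₃ = θ_{t₁} - ½ φ_{t₁t₁}`. The last condition says that `φ` is a potential with
respect to all the variables. (The Lax equations imply its `t₁`-derivative; it contains
`u₂ = φ_{t₁}` and `u₄ = -θ_{t₁t₁} + ⅓ φ_{t₃} + ⅙ φ_{t₁t₁t₁} - (φ_{t₁})²`.) -/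
structure SolvesOddKPWith {m : ℕ} (Ω : Set (OddTimes 𝕜))
    (φ θ : OddTimes 𝕜 → Matrix (Fin m) (Fin m) 𝕂)
    (u : ℕ → OddTimes 𝕜 → Matrix (Fin m) (Fin m) 𝕂) : Prop where
  smooth_phi : OddTimes.SmoothOn Ω φ
  smooth_theta : OddTimes.SmoothOn Ω θ
  smooth_u : ∀ k, 2 ≤ k → OddTimes.SmoothOn Ω (u k)
  u_two : ∀ t ∈ Ω, u 2 t = OddTimes.pd 0 φ t
  u_three : ∀ t ∈ Ω,
    u 3 t = OddTimes.pd 0 θ t - (1 / 2 : 𝕂) • OddTimes.pd 0 (OddTimes.pd 0 φ) t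
  lax_eq : ∀ k : ℕ, ∀ i : ℤ, ∀ t ∈ Ω,
    OddTimes.pd k (PsiDO.lax u i) t =
      PsiDO.comm (OddTimes.pd 0)
        (PsiDO.nonneg (PsiDO.pow (OddTimes.pd 0) (PsiDO.lax u) (2 * k + 1))) (PsiDO.lax u) i t
  potential : ∀ k : ℕ, ∀ t ∈ Ω,
    OddTimes.pd k φ t = PsiDO.pow (OddTimes.pd 0) (PsiDO.lax u) (2 * k + 1) (-1) t

/-- The functions `φ, θ` solve the `m × m` matrix CKP hierarchy on `Ω`: they solve the matrix odd KP
hierarchy with a Lax operator subject to `L + L^* = 0`, and `φᵀ = φ`, `θᵀ = -θ`. -/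
def SolvesMatrixCKP {m : ℕ} (Ω : Set (OddTimes 𝕜))
    (φ θ : OddTimes 𝕜 → Matrix (Fin m) (Fin m) 𝕂) : Prop :=
  (∃ u : ℕ → OddTimes 𝕜 → Matrix (Fin m) (Fin m) 𝕂,
    SolvesOddKPWith Ω φ θ u ∧
    ∀ i : ℤ, ∀ t ∈ Ω,
      PsiDO.lax u i t +
        PsiDO.adjoint (OddTimes.pd 0) (fun f t => (f t)ᵀ) (PsiDO.lax u) i t = 0) ∧
  (∀ t ∈ Ω, (φ t)ᵀ = φ t) ∧ (∀ t ∈ Ω, (θ t)ᵀ = -θ t)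

end Hierarchies

end

noncomputable section

set_option linter.unusedSectionVars false

namespace PsiDO

section Sums

variable {A : Type*} [Ring A]

/-- A formal operator of order at most `p`. -/
def OrderLE (p : ℤ) (P : ℤ → A) : Prop := ∀ i, p < i → P i = 0

theorem OrderLE.mono {p q : ℤ} {P : ℤ → A} (h : OrderLE p P) (hpq : p ≤ q) : OrderLE q P :=
  fun i hi => h i (hpq.trans_lt hi)

theorem mul_eq_sum {δ : A → A} (hδ : δ 0 = 0) {P Q : ℤ → A} {p q : ℤ} (hP : OrderLE p P)
    (hQ : OrderLE q Q) (n : ℤ) {s : Finset (ℤ × ℕ)}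
    (hs : Finset.Icc (n - q) p ×ˢ Finset.range (p + q - n + 1).toNat ⊆ s) :
    mul δ P Q n =
      ∑ x ∈ s, (Ring.choose x.1 x.2 : ℤ) • (P x.1 * δ^[x.2] (Q (n - x.1 + x.2))) := by
  refine finsum_eq_sum_of_support_subset _ ?_
  intro x hx
  apply hs
  by_contra hx'
  apply hx
  by_cases h1 : p < x.1
  · simp [hP _ h1]
  · have h2 : q < n - x.1 + x.2 := by
      by_contra h2
      apply hx'
      simp only [Finset.mem_product, Finset.mem_Icc, Finset.mem_range]
      omega
    simp [hQ _ h2, Function.iterate_fixed hδ]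

theorem OrderLE.mul {δ : A → A} (hδ : δ 0 = 0) {P Q : ℤ → A} {p q : ℤ} (hP : OrderLE p P)
    (hQ : OrderLE q Q) : OrderLE (p + q) (mul δ P Q) := by
  intro n hn
  rw [mul_eq_sum hδ hP hQ n (s := ∅)]
  · simp
  · rw [Finset.Icc_eq_empty (by omega)]; simp

theorem adjoint_eq_sum {δ τ : A → A} (hδ : δ 0 = 0) (hτ : τ 0 = 0) {P : ℤ → A} {p : ℤ}
    (hP : OrderLE p P) (n : ℤ) {M : ℕ} (hM : p < n + M) :
    adjoint δ τ P n = ∑ k ∈ Finset.range M,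
      (((n + k).negOnePow : ℤ) * (Ring.choose (n + k) k : ℤ)) • δ^[k] (τ (P (n + k))) := by
  refine finsum_eq_sum_of_support_subset _ ?_
  intro k hk
  by_contra hk'
  apply hk
  simp only [Finset.coe_range, Set.mem_Iio, not_lt] at hk'
  simp [hP (n + k) (by omega), hτ, Function.iterate_fixed hδ]

theorem OrderLE.adjoint {δ τ : A → A} (hδ : δ 0 = 0) (hτ : τ 0 = 0) {P : ℤ → A} {p : ℤ}
    (hP : OrderLE p P) : OrderLE p (adjoint δ τ P) := by
  intro n hn
  rw [adjoint_eq_sum hδ hτ hP n (M := 0) (by simpa using hn)]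
  simp

/-- The coefficient functions that vanish for all large indices. -/
def boundedAbove (A : Type*) [Ring A] : AddSubgroup (ℤ → A) where
  carrier := {P | ∃ p, OrderLE p P}
  zero_mem' := ⟨0, fun _ _ => rfl⟩
  add_mem' := by
    rintro P Q ⟨p, hp⟩ ⟨q, hq⟩
    refine ⟨max p q, fun i hi => ?_⟩
    simp [hp i (by omega), hq i (by omega)]
  neg_mem' := by
    rintro P ⟨p, hp⟩
    exact ⟨p, fun i hi => by simp [hp i hi]⟩

end Sums

end PsiDO

open PsiDO (OrderLE)

/-- Formal pseudodifferential operators over a commutative ring with derivation `δ`. -/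
def PDO {F K : Type*} [CommRing F] [CommRing K] [Algebra F K] (_δ : Derivation F K K) : Type _ :=
  PsiDO.boundedAbove K

namespace PDO

variable {F K : Type*} [CommRing F] [CommRing K] [Algebra F K] {δ : Derivation F K K}

instance : AddCommGroup (PDO δ) := inferInstanceAs (AddCommGroup (PsiDO.boundedAbove K))

/-- The coefficient of `∂ⁿ`, as an additive map. -/
def coeffHom (δ : Derivation F K K) (n : ℤ) : PDO δ →+ K where
  toFun P := P.1 n
  map_zero' := rfl
  map_add' _ _ := rfl

/-- The coefficient of `∂ⁿ`. -/
def coeff (P : PDO δ) (n : ℤ) : K := coeffHom δ n P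

@[ext] theorem ext {P Q : PDO δ} (h : ∀ n, P.coeff n = Q.coeff n) : P = Q :=
  Subtype.ext (funext h)

@[simp] theorem coeff_zero (n : ℤ) : (0 : PDO δ).coeff n = 0 := rfl
@[simp] theorem coeff_add (P Q : PDO δ) (n : ℤ) : (P + Q).coeff n = P.coeff n + Q.coeff n := rfl
@[simp] theorem coeff_neg (P : PDO δ) (n : ℤ) : (-P).coeff n = -P.coeff n := rfl
@[simp] theorem coeff_sub (P Q : PDO δ) (n : ℤ) : (P - Q).coeff n = P.coeff n - Q.coeff n := rfl
theorem coeff_sum {ι : Type*} (s : Finset ι) (P : ι → PDO δ) (n : ℤ) :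
    (∑ i ∈ s, P i).coeff n = ∑ i ∈ s, (P i).coeff n := map_sum (coeffHom δ n) P s

theorem exists_order (P : PDO δ) : ∃ p, OrderLE p P.coeff := P.2

/-- The operator with the given coefficients. -/
def of (f : ℤ → K) (h : ∃ p, OrderLE p f) : PDO δ := ⟨f, h⟩

@[simp] theorem coeff_of (f : ℤ → K) (h : ∃ p, OrderLE p f) (n : ℤ) :
    (of f h : PDO δ).coeff n = f n := rfl

/-- The operator `a ∂ⁱ`. -/
def mono (a : K) (i : ℤ) : PDO δ :=
  of (fun n => if n = i then a else 0) ⟨i, fun n hn => if_neg (by omega)⟩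

theorem coeff_mono (a : K) (i n : ℤ) : (mono a i : PDO δ).coeff n = if n = i then a else 0 := rfl

theorem order_mono (a : K) (i : ℤ) : OrderLE i (mono a i : PDO δ).coeff :=
  fun n hn => if_neg (by omega)

theorem mono_add (a b : K) (i : ℤ) : (mono (a + b) i : PDO δ) = mono a i + mono b i := by
  ext n; simp only [coeff_mono, coeff_add]; split_ifs <;> simp

instance : Mul (PDO δ) where
  mul P Q := of (PsiDO.mul δ P.coeff Q.coeff) (by
    obtain ⟨p, hp⟩ := P.exists_order
    obtain ⟨q, hq⟩ := Q.exists_order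
    exact ⟨_, hp.mul (map_zero δ) hq⟩)

instance : One (PDO δ) := ⟨mono 1 0⟩

theorem coeff_one (n : ℤ) : (1 : PDO δ).coeff n = if n = 0 then 1 else 0 := rfl

theorem coeff_mul (P Q : PDO δ) (n : ℤ) :
    (P * Q).coeff n = PsiDO.mul δ P.coeff Q.coeff n := rfl

theorem order_mul {P Q : PDO δ} {p q : ℤ} (hP : OrderLE p P.coeff) (hQ : OrderLE q Q.coeff) :
    OrderLE (p + q) (P * Q).coeff := hP.mul (map_zero δ) hQ

theorem coeff_mul_eq_sum {P Q : PDO δ} {p q : ℤ} (hP : OrderLE p P.coeff)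
    (hQ : OrderLE q Q.coeff) (n : ℤ) {s : Finset (ℤ × ℕ)}
    (hs : Finset.Icc (n - q) p ×ˢ Finset.range (p + q - n + 1).toNat ⊆ s) :
    (P * Q).coeff n = ∑ x ∈ s,
      (Ring.choose x.1 x.2 : ℤ) • (P.coeff x.1 * δ^[x.2] (Q.coeff (n - x.1 + x.2))) :=
  PsiDO.mul_eq_sum (map_zero δ) hP hQ n hs

theorem order_add {P Q : PDO δ} {p : ℤ} (hP : OrderLE p P.coeff) (hQ : OrderLE p Q.coeff) :
    OrderLE p (P + Q).coeff := fun n hn => by simp [hP n hn, hQ n hn]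

instance : NonUnitalNonAssocRing (PDO δ) where
  left_distrib P Q R := by
    obtain ⟨p, hp⟩ := P.exists_order
    obtain ⟨q, hq⟩ := Q.exists_order
    obtain ⟨r, hr⟩ := R.exists_order
    replace hq := hq.mono (le_max_left q r)
    replace hr := hr.mono (le_max_right q r)
    ext n
    rw [coeff_add, coeff_mul_eq_sum hp (order_add hq hr) n subset_rfl,
      coeff_mul_eq_sum hp hq n subset_rfl, coeff_mul_eq_sum hp hr n subset_rfl,
      ← Finset.sum_add_distrib]
    refine Finset.sum_congr rfl fun x _ => ?_
    rw [coeff_add, iterate_map_add, mul_add, smul_add]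
  right_distrib P Q R := by
    obtain ⟨p, hp⟩ := P.exists_order
    obtain ⟨q, hq⟩ := Q.exists_order
    obtain ⟨r, hr⟩ := R.exists_order
    replace hp := hp.mono (le_max_left p q)
    replace hq := hq.mono (le_max_right p q)
    ext n
    rw [coeff_add, coeff_mul_eq_sum (order_add hp hq) hr n subset_rfl,
      coeff_mul_eq_sum hp hr n subset_rfl, coeff_mul_eq_sum hq hr n subset_rfl,
      ← Finset.sum_add_distrib]
    refine Finset.sum_congr rfl fun x _ => ?_
    rw [coeff_add, add_mul, smul_add]
  zero_mul P := by
    ext n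
    simp [coeff_mul, PsiDO.mul]
  mul_zero P := by
    ext n
    simp [coeff_mul, PsiDO.mul, Function.iterate_fixed (map_zero δ)]

/-- A map that raises the order by at most a fixed amount is continuous for the order topology. -/
def BoundedShift (f : PDO δ → PDO δ) : Prop :=
  ∃ c : ℤ, ∀ p P, OrderLE p P.coeff → OrderLE (p + c) (f P).coeff

theorem BoundedShift.comp {f g : PDO δ → PDO δ} (hf : BoundedShift f) (hg : BoundedShift g) :
    BoundedShift (fun P => f (g P)) := by
  obtain ⟨c, hc⟩ := hf
  obtain ⟨d, hd⟩ := hg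
  exact ⟨d + c, fun p P hP => by rw [← add_assoc]; exact hc _ _ (hd _ _ hP)⟩

theorem BoundedShift.mul_left (Q : PDO δ) : BoundedShift (fun P => Q * P) := by
  obtain ⟨q, hq⟩ := Q.exists_order
  exact ⟨q, fun p P hP => by rw [add_comm]; exact order_mul hq hP⟩

theorem BoundedShift.mul_right (Q : PDO δ) : BoundedShift (fun P => P * Q) := by
  obtain ⟨q, hq⟩ := Q.exists_order
  exact ⟨q, fun p P hP => order_mul hP hq⟩

theorem BoundedShift.neg {f : PDO δ → PDO δ} (hf : BoundedShift f) :
    BoundedShift (fun P => -f P) := by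
  obtain ⟨c, hc⟩ := hf
  exact ⟨c, fun p P hP n hn => by simp [hc p P hP n hn]⟩

/-- Additive maps of bounded shift are determined by their values on monomials. -/
theorem eq_of_mono {f g : PDO δ → PDO δ} (fadd : ∀ P Q, f (P + Q) = f P + f Q)
    (gadd : ∀ P Q, g (P + Q) = g P + g Q) (hf : BoundedShift f) (hg : BoundedShift g)
    (h : ∀ a i, f (mono a i) = g (mono a i)) (P : PDO δ) : f P = g P := by
  obtain ⟨c, hc⟩ := hf
  obtain ⟨d, hd⟩ := hg
  obtain ⟨p, hp⟩ := P.exists_order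
  ext n
  let N := n - 1 - max c d
  let P₀ : PDO δ := ∑ i ∈ Finset.Icc (N + 1) p, mono (P.coeff i) i
  have h1 : OrderLE N (P - P₀).coeff := by
    intro i hi
    simp only [P₀, coeff_sub, coeff_sum, coeff_mono, Finset.sum_ite_eq, Finset.mem_Icc]
    split_ifs with h2
    · simp
    · rw [hp i (by omega)]; simp
  have h2 : f P₀ = g P₀ := by
    let f' : PDO δ →+ PDO δ := AddMonoidHom.mk' f fadd
    let g' : PDO δ →+ PDO δ := AddMonoidHom.mk' g gadd
    change f' P₀ = g' P₀
    simp only [P₀, map_sum]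
    exact Finset.sum_congr rfl fun i _ => h _ _
  have h3 : P = (P - P₀) + P₀ := by abel
  rw [h3, fadd, gadd, h2, coeff_add, coeff_add, hc _ _ h1 n (by omega), hd _ _ h1 n (by omega)]

theorem coeff_mono_mul (a : K) (i : ℤ) {Q : PDO δ} {q : ℤ} (hQ : OrderLE q Q.coeff) (n : ℤ)
    {M : ℕ} (hM : q + i < n + M) :
    (mono a i * Q).coeff n = ∑ k ∈ Finset.range M,
      (Ring.choose i k : ℤ) • (a * δ^[k] (Q.coeff (n - i + k))) := by
  rw [coeff_mul_eq_sum (order_mono a i) hQ n (s := (Finset.Icc (n - q) i ∪ {i}) ×ˢ Finset.range M)]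
  · rw [Finset.sum_product, Finset.sum_eq_single i]
    · exact Finset.sum_congr rfl fun k _ => by simp [coeff_mono]
    · intro j _ hj
      exact Finset.sum_eq_zero fun k _ => by simp [coeff_mono, hj]
    · simp
  · refine Finset.product_subset_product Finset.subset_union_left ?_
    intro k
    simp only [Finset.mem_range]
    omega

theorem coeff_mono_zero_mul (a : K) (Q : PDO δ) (n : ℤ) :
    (mono a 0 * Q).coeff n = a * Q.coeff n := by
  obtain ⟨q, hq⟩ := Q.exists_order
  rw [coeff_mono_mul a 0 hq n (M := (q - n).toNat + 1) (by omega), Finset.sum_range_succ']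
  simp [Ring.choose_zero_succ]

theorem coeff_mono_one_mul (Q : PDO δ) (n : ℤ) :
    (mono 1 1 * Q).coeff n = Q.coeff (n - 1) + δ (Q.coeff n) := by
  obtain ⟨q, hq⟩ := Q.exists_order
  rw [coeff_mono_mul 1 1 hq n (M := (q - n).toNat + 2) (by omega), Finset.sum_range_succ',
    Finset.sum_range_succ', Finset.sum_eq_zero]
  · simp [add_comm]
  · intro k _
    have : (Ring.choose (1 : ℤ) (k + 1 + 1) : ℤ) = 0 := by
      have := Ring.choose_natCast (R := ℤ) 1 (k + 1 + 1)
      rw [Nat.choose_eq_zero_of_lt (by omega)] at this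
      simpa using this
    rw [this]; simp

theorem coeff_mul_mono {b : K} (hb : δ b = 0) (j : ℤ) (P : PDO δ) (n : ℤ) :
    (P * mono b j).coeff n = P.coeff (n - j) * b := by
  obtain ⟨p, hp⟩ := P.exists_order
  rw [coeff_mul_eq_sum hp (order_mono b j) n (s := (Finset.Icc (n - j) p ∪ {n - j}) ×ˢ
    (Finset.range (p + j - n + 1).toNat ∪ {0})) (Finset.product_subset_product
      Finset.subset_union_left Finset.subset_union_left), Finset.sum_eq_single (n - j, 0)]
  · simp [coeff_mono]
  · rintro ⟨i, k⟩ _ h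
    rcases k with _ | k
    · have : i ≠ n - j := by rintro rfl; exact h rfl
      simp only [coeff_mono]
      rw [if_neg (by omega)]
      simp
    · have h0 : ∀ c : K, δ c = 0 → δ^[k + 1] c = 0 := by
        intro c hc
        rw [Function.iterate_succ_apply, hc, Function.iterate_fixed (map_zero δ)]
      have : δ (if n - i + ((k + 1 : ℕ) : ℤ) = j then b else 0) = 0 := by split_ifs <;> simp [hb]
      simp only [coeff_mono]
      rw [h0 _ this]
      simp
  · simp

theorem mono_one_one_mul_mono_mul (i : ℤ) (Q : PDO δ) :
    mono 1 1 * (mono 1 i * Q) = mono 1 (i + 1) * Q := by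
  obtain ⟨q, hq⟩ := Q.exists_order
  ext n
  let M := (q + i - n).toNat + 1
  rw [coeff_mono_one_mul, coeff_mono_mul 1 i hq (n - 1) (M := M + 1) (by omega),
    coeff_mono_mul 1 i hq n (M := M) (by omega),
    coeff_mono_mul 1 (i + 1) hq n (M := M + 1) (by omega), Finset.sum_range_succ',
    Finset.sum_range_succ' _ M, map_sum, add_right_comm, ← Finset.sum_add_distrib]
  congr 1
  · refine Finset.sum_congr rfl fun k _ => ?_
    rw [Ring.choose_succ_succ, map_zsmul, add_smul, add_comm, one_mul, one_mul, one_mul,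
      ← Function.iterate_succ_apply' (f := δ)]
    push_cast
    rw [show n - 1 - i + ((k : ℤ) + 1) = n - i + k by ring,
      show n - (i + 1) + ((k : ℤ) + 1) = n - i + k by ring]
  · simp only [Ring.choose_zero_right]
    rw [show n - 1 - i = n - (i + 1) by ring]

theorem mono_eq (a : K) (i : ℤ) : (mono a i : PDO δ) = mono a 0 * mono 1 i := by
  ext n
  rw [coeff_mono_zero_mul]
  simp [coeff_mono]

theorem mono_zero_mul_mul (a : K) (P Q : PDO δ) :
    (mono a 0 * P) * Q = mono a 0 * (P * Q) := by
  obtain ⟨p, hp⟩ := P.exists_order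
  obtain ⟨q, hq⟩ := Q.exists_order
  have hp' : OrderLE p (mono a 0 * P).coeff := by simpa using order_mul (order_mono (δ := δ) a 0) hp
  ext n
  rw [coeff_mono_zero_mul, coeff_mul_eq_sum hp hq n subset_rfl,
    coeff_mul_eq_sum hp' hq n subset_rfl, Finset.mul_sum]
  refine Finset.sum_congr rfl fun x _ => ?_
  rw [coeff_mono_zero_mul, mul_smul_comm, mul_assoc]

theorem mono_one_one_mul_mono_zero_mul (a : K) (Q : PDO δ) :
    mono 1 1 * (mono a 0 * Q) = mono a 0 * (mono 1 1 * Q) + mono (δ a) 0 * Q := by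
  ext n
  simp only [coeff_add, coeff_mono_zero_mul, coeff_mono_one_mul, Derivation.leibniz, smul_eq_mul]
  ring

theorem mono_one_zero_mul (Q : PDO δ) : mono 1 0 * Q = Q := by
  ext n; simp [coeff_mono_zero_mul]

theorem mono_mul_mono_one {a : K} (i j : ℤ) : (mono a i * mono 1 j : PDO δ) = mono a (i + j) := by
  ext n
  rw [coeff_mul_mono (by simp)]
  simp only [coeff_mono, mul_one]
  congr 1
  apply propext
  omega

theorem mono_one_one_mul_mul (P Q : PDO δ) : (mono 1 1 * P) * Q = mono 1 1 * (P * Q) := by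
  refine eq_of_mono (f := fun P => (mono 1 1 * P) * Q) (g := fun P => mono 1 1 * (P * Q))
    (by simp [mul_add, add_mul]) (by simp [mul_add, add_mul])
    ((BoundedShift.mul_right Q).comp (BoundedShift.mul_left _))
    ((BoundedShift.mul_left _).comp (BoundedShift.mul_right Q)) (fun a i => ?_) P
  have h := mono_one_one_mul_mono_mul i (mono 1 0 : PDO δ)
  simp only [mono_mul_mono_one, add_zero] at h
  rw [mono_eq a i, mono_one_one_mul_mono_zero_mul, mono_mul_mono_one, h, add_mul, mono_zero_mul_mul,
    mono_zero_mul_mul, mono_zero_mul_mul, mono_one_one_mul_mono_zero_mul, mono_one_one_mul_mono_mul]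

theorem mono_one_one_mul_injective : Function.Injective (fun Q : PDO δ => mono 1 1 * Q) := by
  have h0 : ∀ Q : PDO δ, mono 1 1 * Q = 0 → Q = 0 := by
    intro Q hQ
    obtain ⟨q, hq⟩ := Q.exists_order
    have h1 : ∀ n, Q.coeff (n - 1) = -δ (Q.coeff n) := fun n => by
      have := congrArg (fun P => coeff P n) hQ
      simp only [coeff_mono_one_mul, coeff_zero] at this
      exact eq_neg_of_add_eq_zero_left this
    have h2 : ∀ k : ℕ, Q.coeff (q + 1 - k) = 0 := by
      intro k
      induction k with
      | zero => exact hq _ (by simp)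
      | succ k ih =>
        push_cast
        rw [show q + 1 - ((k : ℤ) + 1) = q + 1 - k - 1 by ring, h1, ih, map_zero, neg_zero]
    ext n
    by_cases hn : q < n
    · exact hq n hn
    · have := h2 (q + 1 - n).toNat
      rwa [show q + 1 - ((q + 1 - n).toNat : ℤ) = n by omega] at this
  intro P Q h
  have := h0 (P - Q) (by rw [mul_sub]; exact sub_eq_zero.2 h)
  exact sub_eq_zero.1 this

theorem mono_one_mul_mul (i : ℤ) (P Q : PDO δ) : (mono 1 i * P) * Q = mono 1 i * (P * Q) := by
  induction i with
  | zero => rw [mono_one_zero_mul, mono_one_zero_mul]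
  | succ i ih =>
    rw [← mono_one_one_mul_mono_mul, mono_one_one_mul_mul, ih, mono_one_one_mul_mono_mul]
  | pred i ih =>
    apply mono_one_one_mul_injective
    simp only
    rw [← mono_one_one_mul_mul, mono_one_one_mul_mono_mul, mono_one_one_mul_mono_mul]
    simpa using ih

protected theorem mul_assoc (P Q R : PDO δ) : P * Q * R = P * (Q * R) := by
  refine eq_of_mono (f := fun P => P * Q * R) (g := fun P => P * (Q * R))
    (by simp [add_mul]) (by simp [add_mul])
    ((BoundedShift.mul_right R).comp (BoundedShift.mul_right Q))
    (BoundedShift.mul_right _) (fun a i => ?_) P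
  rw [mono_eq, mono_zero_mul_mul, mono_zero_mul_mul, mono_zero_mul_mul, mono_one_mul_mul]

instance : Ring (PDO δ) :=
  { (inferInstance : NonUnitalNonAssocRing (PDO δ)), (inferInstance : One (PDO δ)) with
    mul_assoc := PDO.mul_assoc
    one_mul := mono_one_zero_mul
    mul_one := fun P => by
      ext n
      rw [show (1 : PDO δ) = mono 1 0 from rfl, coeff_mul_mono (by simp)]
      simp
    zsmul := fun n P => n • P
    zsmul_zero' := zero_zsmul
    zsmul_succ' := fun n P => SubNegMonoid.zsmul_succ' n P
    zsmul_neg' := fun n P => SubNegMonoid.zsmul_neg' n P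
    neg_add_cancel := neg_add_cancel }

/-- The embedding of the coefficient ring. -/
def C (δ : Derivation F K K) : K →+* PDO δ where
  toFun a := mono a 0
  map_one' := rfl
  map_mul' a b := by
    ext n
    rw [coeff_mono_zero_mul]
    simp [coeff_mono]
  map_zero' := by ext n; simp [coeff_mono]
  map_add' a b := mono_add a b 0

theorem C_apply (a : K) : C δ a = mono a 0 := rfl

theorem coeff_C_mul (a : K) (P : PDO δ) (n : ℤ) : (C δ a * P).coeff n = a * P.coeff n :=
  coeff_mono_zero_mul a P n

theorem mono_one_mul_mono_one (i j : ℤ) : (mono 1 i * mono 1 j : PDO δ) = mono 1 (i + j) :=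
  mono_mul_mono_one i j

theorem mono_one_one_mul_C (a : K) : mono 1 1 * C δ a = C δ a * mono 1 1 + C δ (δ a) := by
  have := mono_one_one_mul_mono_zero_mul a (1 : PDO δ)
  simpa [C_apply] using this

section Adjoint

/-- The formal adjoint (with trivial involution of the coefficients). -/
def adj (P : PDO δ) : PDO δ :=
  of (PsiDO.adjoint δ id P.coeff) (by
    obtain ⟨p, hp⟩ := P.exists_order
    exact ⟨p, hp.adjoint (map_zero δ) rfl⟩)

theorem coeff_adj (P : PDO δ) (n : ℤ) : (adj P).coeff n = PsiDO.adjoint δ id P.coeff n := rfl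

theorem coeff_adj_eq_sum {P : PDO δ} {p : ℤ} (hP : OrderLE p P.coeff) (n : ℤ) {M : ℕ}
    (hM : p < n + M) : (adj P).coeff n = ∑ k ∈ Finset.range M,
      (((n + k).negOnePow : ℤ) * (Ring.choose (n + k) k : ℤ)) • δ^[k] (P.coeff (n + k)) :=
  PsiDO.adjoint_eq_sum (map_zero δ) rfl hP n hM

theorem adj_add (P Q : PDO δ) : adj (P + Q) = adj P + adj Q := by
  obtain ⟨p, hp⟩ := P.exists_order
  obtain ⟨q, hq⟩ := Q.exists_order
  replace hp := hp.mono (le_max_left p q)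
  replace hq := hq.mono (le_max_right p q)
  ext n
  have hM : max p q < n + ((max p q - n).toNat + 1 : ℕ) := by push_cast; omega
  rw [coeff_add, coeff_adj_eq_sum hp n hM, coeff_adj_eq_sum hq n hM,
    coeff_adj_eq_sum (order_add hp hq) n hM, ← Finset.sum_add_distrib]
  refine Finset.sum_congr rfl fun k _ => ?_
  rw [coeff_add, iterate_map_add, smul_add]

/-- The formal adjoint as an additive map. -/
def adjHom (δ : Derivation F K K) : PDO δ →+ PDO δ := AddMonoidHom.mk' adj adj_add

theorem adj_sum {ι : Type*} (s : Finset ι) (P : ι → PDO δ) :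
    adj (∑ i ∈ s, P i) = ∑ i ∈ s, adj (P i) := map_sum (adjHom δ) P s

theorem adj_neg (P : PDO δ) : adj (-P) = -adj P := map_neg (adjHom δ) P

theorem adj_zero : adj (0 : PDO δ) = 0 := map_zero (adjHom δ)

theorem BoundedShift.adj : BoundedShift (adj : PDO δ → PDO δ) :=
  ⟨0, fun p P hP => by rw [add_zero]; exact hP.adjoint (map_zero δ) rfl⟩

theorem adj_mono (a : K) (i : ℤ) :
    adj (mono a i : PDO δ) = (i.negOnePow : ℤ) • (mono 1 i * C δ a) := by
  ext n
  have hM : i < n + ((i - n).toNat + 1 : ℕ) := by push_cast; omega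
  change _ = (coeffHom δ n) _
  rw [map_zsmul, coeff_adj_eq_sum (order_mono a i) n hM]
  change _ = _ • (mono 1 i * mono a 0 : PDO δ).coeff n
  rw [coeff_mono_mul 1 i (order_mono a 0) n (by rwa [zero_add]), Finset.smul_sum]
  refine Finset.sum_congr rfl fun k _ => ?_
  simp only [coeff_mono, one_mul]
  by_cases h : n + k = i
  · rw [if_pos h, if_pos (by omega), h, mul_smul]
  · rw [if_neg h, if_neg (by omega), Function.iterate_fixed (map_zero δ)]
    simp

theorem adj_C (a : K) : adj (C δ a) = C δ a := by
  rw [C_apply, adj_mono]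
  simp [mono_one_zero_mul, C_apply]

theorem adj_C_mul (a : K) (P : PDO δ) : adj (C δ a * P) = adj P * C δ a := by
  refine eq_of_mono (f := fun P => adj (C δ a * P)) (g := fun P => adj P * C δ a)
    (by simp [mul_add, adj_add]) (by simp [add_mul, adj_add])
    (BoundedShift.adj.comp (BoundedShift.mul_left _))
    ((BoundedShift.mul_right _).comp BoundedShift.adj) (fun b i => ?_) P
  have : C δ a * mono b i = mono (a * b) i := by
    ext n; rw [coeff_C_mul]; simp [coeff_mono]
  rw [this, adj_mono, adj_mono, smul_mul_assoc, mul_assoc, ← map_mul, mul_comm a b]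

theorem adj_mono_one_one_mul (P : PDO δ) : adj (mono 1 1 * P) = -(adj P * mono 1 1) := by
  refine eq_of_mono (f := fun P => adj (mono 1 1 * P)) (g := fun P => -(adj P * mono 1 1))
    (by simp [mul_add, adj_add]) (by simp [add_mul, adj_add, add_comm])
    (BoundedShift.adj.comp (BoundedShift.mul_left _))
    ((BoundedShift.mul_right _).comp BoundedShift.adj).neg (fun a i => ?_) P
  have h : mono 1 1 * mono a i = (mono a (i + 1) + mono (δ a) i : PDO δ) := by
    rw [mono_eq a i, mono_one_one_mul_mono_zero_mul, mono_one_mul_mono_one, ← mono_eq, ← mono_eq,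
      add_comm 1 i]
  rw [h, adj_add, adj_mono, adj_mono, adj_mono, smul_mul_assoc, mul_assoc,
    ← sub_eq_of_eq_add (mono_one_one_mul_C a), mul_sub, ← mul_assoc, mono_one_mul_mono_one,
    Int.negOnePow_succ, smul_sub]
  simp only [Units.val_neg, neg_smul]
  abel

theorem adj_mono_one_mul (i : ℤ) (P : PDO δ) :
    adj (mono 1 i * P) = (i.negOnePow : ℤ) • (adj P * mono 1 i) := by
  induction i with
  | zero =>
    rw [show (mono 1 0 : PDO δ) = 1 from rfl]
    simp
  | succ i ih =>
    rw [← mono_one_one_mul_mono_mul, adj_mono_one_one_mul, ih, smul_mul_assoc, mul_assoc,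
      mono_one_mul_mono_one, Int.negOnePow_succ]
    simp
  | pred i ih =>
    rw [show -(i : ℤ) = -(i : ℤ) - 1 + 1 by ring, ← mono_one_one_mul_mono_mul,
      adj_mono_one_one_mul] at ih
    have h := congrArg (fun X => -(X * mono 1 (-1))) ih
    simp only [neg_mul, neg_neg, mul_assoc, mono_one_mul_mono_one, smul_mul_assoc,
      add_neg_cancel, Int.negOnePow_succ, add_neg_cancel_right, Units.val_neg, neg_smul] at h
    rwa [show (mono 1 0 : PDO δ) = 1 from rfl, mul_one] at h

theorem adj_mul (P Q : PDO δ) : adj (P * Q) = adj Q * adj P := by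
  refine eq_of_mono (f := fun P => adj (P * Q)) (g := fun P => adj Q * adj P)
    (by simp [add_mul, adj_add]) (by simp [mul_add, adj_add])
    (BoundedShift.adj.comp (BoundedShift.mul_right _))
    ((BoundedShift.mul_left _).comp BoundedShift.adj) (fun a i => ?_) P
  rw [adj_mono, mono_eq, mul_assoc, ← C_apply, adj_C_mul, adj_mono_one_mul, smul_mul_assoc,
    mul_smul_comm, mul_assoc]

end Adjoint

section Evolution

/-- The coefficientwise action of a derivation `d` of the coefficient ring. -/
def evol (d : Derivation F K K) (P : PDO δ) : PDO δ :=
  of (fun n => d (P.coeff n)) (by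
    obtain ⟨p, hp⟩ := P.exists_order
    exact ⟨p, fun n hn => by simp only [hp n hn, map_zero]⟩)

theorem coeff_evol (d : Derivation F K K) (P : PDO δ) (n : ℤ) :
    (evol d P).coeff n = d (P.coeff n) := rfl

theorem evol_add (d : Derivation F K K) (P Q : PDO δ) :
    evol d (P + Q) = evol d P + evol d Q := by
  ext n; simp [coeff_evol]

theorem evol_sum (d : Derivation F K K) {ι : Type*} (s : Finset ι) (P : ι → PDO δ) :
    evol d (∑ i ∈ s, P i) = ∑ i ∈ s, evol d (P i) :=
  map_sum (AddMonoidHom.mk' (evol (δ := δ) d) (evol_add d)) P s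

theorem evol_mul {d : Derivation F K K} (hd : ∀ a, d (δ a) = δ (d a)) (P Q : PDO δ) :
    evol d (P * Q) = evol d P * Q + P * evol d Q := by
  obtain ⟨p, hp⟩ := P.exists_order
  obtain ⟨q, hq⟩ := Q.exists_order
  have hp' : OrderLE p (evol d P).coeff := fun n hn => by rw [coeff_evol, hp n hn, map_zero]
  have hq' : OrderLE q (evol d Q).coeff := fun n hn => by rw [coeff_evol, hq n hn, map_zero]
  ext n
  rw [coeff_add, coeff_evol, coeff_mul_eq_sum hp hq n subset_rfl,
    coeff_mul_eq_sum hp' hq n subset_rfl, coeff_mul_eq_sum hp hq' n subset_rfl, map_sum,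
    ← Finset.sum_add_distrib]
  refine Finset.sum_congr rfl fun x _ => ?_
  have hk : ∀ (k : ℕ) (a : K), d (δ^[k] a) = δ^[k] (d a) := by
    intro k a
    induction k with
    | zero => rfl
    | succ k ih => rw [Function.iterate_succ_apply', hd, ih, ← Function.iterate_succ_apply' (f := δ)]
  rw [map_zsmul, Derivation.leibniz, hk, coeff_evol, coeff_evol, ← smul_add, smul_eq_mul,
    smul_eq_mul]
  ring

end Evolution

variable {l m n : Type*}

/-- The matrix coefficient of `∂ᵏ`. -/
def mcoeff (k : ℤ) (P : Matrix l m (PDO δ)) : Matrix l m K := P.map fun x => x.coeff k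

theorem ext_mcoeff {P Q : Matrix l m (PDO δ)} (h : ∀ k, mcoeff k P = mcoeff k Q) : P = Q := by
  ext i j k
  exact congrFun (congrFun (h k) i) j

@[simp] theorem mcoeff_add (k : ℤ) (P Q : Matrix l m (PDO δ)) :
    mcoeff k (P + Q) = mcoeff k P + mcoeff k Q := rfl

@[simp] theorem mcoeff_sub (k : ℤ) (P Q : Matrix l m (PDO δ)) :
    mcoeff k (P - Q) = mcoeff k P - mcoeff k Q := rfl

@[simp] theorem mcoeff_neg (k : ℤ) (P : Matrix l m (PDO δ)) :
    mcoeff k (-P) = -mcoeff k P := rfl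

@[simp] theorem mcoeff_zero (k : ℤ) : mcoeff k (0 : Matrix l m (PDO δ)) = 0 := rfl

theorem mcoeff_one [DecidableEq m] (k : ℤ) :
    mcoeff k (1 : Matrix m m (PDO δ)) = if k = 0 then 1 else 0 := by
  ext i j
  by_cases h : i = j
  · subst h; simp only [mcoeff, Matrix.map_apply, Matrix.one_apply_eq, coeff_one]
    split_ifs <;> simp
  · simp only [mcoeff, Matrix.map_apply, Matrix.one_apply_ne h, coeff_zero]
    split_ifs <;> simp [h]

/-- Matrices of operators of order at most `p`. -/
def MOrderLE (p : ℤ) (P : Matrix l m (PDO δ)) : Prop := ∀ k, p < k → mcoeff k P = 0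

theorem MOrderLE.mono {p q : ℤ} {P : Matrix l m (PDO δ)} (h : MOrderLE p P) (hpq : p ≤ q) :
    MOrderLE q P := fun k hk => h k (hpq.trans_lt hk)

theorem MOrderLE.neg {p : ℤ} {P : Matrix l m (PDO δ)} (hP : MOrderLE p P) :
    MOrderLE p (-P) := fun k hk => by simp [hP k hk]

theorem MOrderLE.sub {p : ℤ} {P Q : Matrix l m (PDO δ)} (hP : MOrderLE p P) (hQ : MOrderLE p Q) :
    MOrderLE p (P - Q) := fun k hk => by simp [hP k hk, hQ k hk]

theorem MOrderLE.entry {p : ℤ} {P : Matrix l m (PDO δ)} (hP : MOrderLE p P) (i : l) (j : m) :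
    OrderLE p (P i j).coeff := fun k hk => congrFun (congrFun (hP k hk) i) j

theorem exists_morderLE [Finite l] [Finite m] (P : Matrix l m (PDO δ)) : ∃ p, MOrderLE p P := by
  choose f hf using fun x : l × m => (P x.1 x.2).exists_order
  obtain ⟨p, hp⟩ := (Set.finite_range f).bddAbove
  exact ⟨p, fun k hk => by ext i j; exact hf (i, j) k ((hp ⟨_, rfl⟩).trans_lt hk)⟩

theorem MOrderLE.mul [Fintype m] {p q : ℤ} {P : Matrix l m (PDO δ)} {Q : Matrix m n (PDO δ)}
    (hP : MOrderLE p P) (hQ : MOrderLE q Q) : MOrderLE (p + q) (P * Q) := by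
  intro k hk
  ext i j
  simp only [mcoeff, Matrix.map_apply, Matrix.mul_apply, coeff_sum, Matrix.zero_apply]
  exact Finset.sum_eq_zero fun x _ => order_mul (hP.entry i x) (hQ.entry x j) k hk

theorem mcoeff_mul_leading [Fintype m] {p q : ℤ} {P : Matrix l m (PDO δ)} {Q : Matrix m n (PDO δ)}
    (hP : MOrderLE p P) (hQ : MOrderLE q Q) :
    mcoeff (p + q) (P * Q) = mcoeff p P * mcoeff q Q := by
  ext i j
  simp only [mcoeff, Matrix.map_apply, Matrix.mul_apply, coeff_sum]
  refine Finset.sum_congr rfl fun x _ => ?_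
  rw [coeff_mul_eq_sum (hP.entry i x) (hQ.entry x j) (p + q) (s := {(p, 0)})]
  · simp
  · rw [show p + q - q = p by ring, show (p + q - (p + q) + 1).toNat = 1 by simp]
    simp

/-- Embedding of matrices over the coefficient ring. -/
def MC (δ : Derivation F K K) (X : Matrix l m K) : Matrix l m (PDO δ) := X.map (C δ)

theorem MC_mul [Fintype m] (X : Matrix l m K) (Y : Matrix m n K) :
    MC δ (X * Y) = MC δ X * MC δ Y := Matrix.map_mul

theorem MC_add (X Y : Matrix l m K) : MC δ (X + Y) = MC δ X + MC δ Y :=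
  Matrix.map_add _ (map_add (C δ)) X Y

theorem MC_sub (X Y : Matrix l m K) : MC δ (X - Y) = MC δ X - MC δ Y :=
  Matrix.map_sub _ (map_sub (C δ)) X Y

theorem MC_neg (X : Matrix l m K) : MC δ (-X) = -MC δ X := by
  ext1 i j; simp [MC]

theorem MC_zero : MC δ (0 : Matrix l m K) = 0 := by
  ext1 i j; simp [MC]

theorem MC_one [DecidableEq m] : MC δ (1 : Matrix m m K) = 1 :=
  Matrix.map_one _ (map_zero (C δ)) (map_one (C δ))

theorem mcoeff_MC (X : Matrix l m K) (k : ℤ) : mcoeff k (MC δ X) = if k = 0 then X else 0 := by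
  ext i j
  simp only [mcoeff, MC, Matrix.map_apply, C_apply, coeff_mono]
  split_ifs <;> simp

theorem mcoeff_MC_mul [Fintype m] (X : Matrix l m K) (P : Matrix m n (PDO δ)) (k : ℤ) :
    mcoeff k (MC δ X * P) = X * mcoeff k P := by
  ext i j
  simp [mcoeff, MC, Matrix.mul_apply, coeff_sum, coeff_C_mul]

theorem mcoeff_mul_MC [Fintype m] {X : Matrix m n K} (hX : X.map δ = 0) (P : Matrix l m (PDO δ))
    (k : ℤ) : mcoeff k (P * MC δ X) = mcoeff k P * X := by
  ext i j
  simp only [mcoeff, MC, Matrix.mul_apply, coeff_sum, Matrix.map_apply]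
  refine Finset.sum_congr rfl fun x _ => ?_
  rw [C_apply, coeff_mul_mono (congrFun (congrFun hX x) j), sub_zero]

/-- The scalar matrix `∂`. -/
def dM (δ : Derivation F K K) (m : Type*) [DecidableEq m] : Matrix m m (PDO δ) :=
  Matrix.diagonal fun _ => mono 1 1

theorem mcoeff_dM [DecidableEq m] (k : ℤ) : mcoeff k (dM δ m) = if k = 1 then 1 else 0 := by
  ext i j
  simp only [mcoeff, Matrix.map_apply, dM, Matrix.diagonal_apply]
  by_cases h : i = j
  · subst h; simp only [if_true, coeff_mono]; split_ifs <;> simp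
  · simp only [h, if_false, coeff_zero]; split_ifs <;> simp [h]

theorem mcoeff_dM_mul [Fintype l] [DecidableEq l] (P : Matrix l m (PDO δ)) (k : ℤ) :
    mcoeff k (dM δ l * P) = mcoeff (k - 1) P + (mcoeff k P).map δ := by
  ext i j
  simp [mcoeff, dM, Matrix.diagonal_mul, coeff_mono_one_mul]

theorem mcoeff_mul_dM [Fintype m] [DecidableEq m] (P : Matrix l m (PDO δ)) (k : ℤ) :
    mcoeff k (P * dM δ m) = mcoeff (k - 1) P := by
  ext i j
  simp [mcoeff, dM, Matrix.mul_diagonal, coeff_mul_mono]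

variable [Fintype l] [DecidableEq l] [Fintype m] [DecidableEq m] in
theorem dM_mul_MC (X : Matrix l m K) :
    dM δ l * MC δ X = MC δ X * dM δ m + MC δ (X.map δ) := by
  ext1 i j
  simp [MC, dM, Matrix.diagonal_mul, Matrix.mul_diagonal, mono_one_one_mul_C]

variable [Fintype l] [DecidableEq l] [Fintype m] [DecidableEq m] in
theorem dM_mul_MC_of_const {X : Matrix l m K} (hX : X.map δ = 0) :
    dM δ l * MC δ X = MC δ X * dM δ m := by
  rw [dM_mul_MC, hX, MC_zero, add_zero]

variable [Fintype l] [DecidableEq l] [Fintype m] [DecidableEq m] in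
theorem dM_mul_of_const {P : Matrix l m (PDO δ)} (h : ∀ k, (mcoeff k P).map δ = 0) :
    dM δ l * P = P * dM δ m :=
  ext_mcoeff fun k => by rw [mcoeff_dM_mul, mcoeff_mul_dM, h, add_zero]

section Adjoint

/-- The formal adjoint of a matrix of operators. -/
def madj (P : Matrix l m (PDO δ)) : Matrix m l (PDO δ) := Pᵀ.map adj

theorem madj_mul [Fintype m] (P : Matrix l m (PDO δ)) (Q : Matrix m n (PDO δ)) :
    madj (P * Q) = madj Q * madj P := by
  ext1 i j
  simp [madj, Matrix.mul_apply, adj_sum, adj_mul]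

theorem madj_add (P Q : Matrix l m (PDO δ)) : madj (P + Q) = madj P + madj Q := by
  ext1 i j; simp [madj, adj_add]

theorem madj_neg (P : Matrix l m (PDO δ)) : madj (-P) = -madj P := by
  ext1 i j; simp [madj, adj_neg]

theorem madj_sub (P Q : Matrix l m (PDO δ)) : madj (P - Q) = madj P - madj Q := by
  rw [sub_eq_add_neg, madj_add, madj_neg, sub_eq_add_neg]

theorem madj_MC (X : Matrix l m K) : madj (MC δ X) = MC δ Xᵀ := by
  ext1 i j; simp [madj, MC, adj_C]

theorem madj_one [DecidableEq m] : madj (1 : Matrix m m (PDO δ)) = 1 := by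
  rw [← MC_one, madj_MC, Matrix.transpose_one]

theorem madj_dM [DecidableEq m] : madj (dM δ m) = -dM δ m := by
  ext1 i j
  by_cases h : i = j
  · subst h
    simp [madj, dM, adj_mono]
  · simp [madj, dM, h, adj_zero]

end Adjoint

section Evolution

/-- The entrywise, coefficientwise action of a derivation `d` of the coefficient ring. -/
def mevol (d : Derivation F K K) (P : Matrix l m (PDO δ)) : Matrix l m (PDO δ) := P.map (evol d)

theorem mcoeff_mevol (d : Derivation F K K) (P : Matrix l m (PDO δ)) (k : ℤ) :
    mcoeff k (mevol d P) = (mcoeff k P).map d := rfl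

theorem mevol_mul [Fintype m] {d : Derivation F K K} (hd : ∀ a, d (δ a) = δ (d a))
    (P : Matrix l m (PDO δ)) (Q : Matrix m n (PDO δ)) :
    mevol d (P * Q) = mevol d P * Q + P * mevol d Q := by
  ext1 i j
  simp [mevol, Matrix.mul_apply, evol_sum, evol_mul hd, Finset.sum_add_distrib]

theorem mevol_of_const {d : Derivation F K K} {P : Matrix l m (PDO δ)}
    (h : ∀ k, (mcoeff k P).map d = 0) : mevol d P = 0 :=
  ext_mcoeff fun k => h k

theorem mevol_MC (d : Derivation F K K) (X : Matrix l m K) :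
    mevol d (MC δ X) = MC δ (X.map d) :=
  ext_mcoeff fun k => by
    rw [mcoeff_mevol, mcoeff_MC, mcoeff_MC]
    split_ifs
    · rfl
    · ext i j; simp

theorem mevol_sub (d : Derivation F K K) (P Q : Matrix l m (PDO δ)) :
    mevol d (P - Q) = mevol d P - mevol d Q :=
  ext_mcoeff fun k => by
    simp only [mcoeff_mevol, mcoeff_sub]
    ext i j; simp

end Evolution

section Inverse

theorem eq_zero_of_forall_order {P : Matrix l n (PDO δ)} (h : ∀ k : ℕ, MOrderLE (-k) P) : P = 0 :=
  ext_mcoeff fun k => h ((-k).toNat + 1) k (by push_cast; omega)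

theorem morderLE_one [DecidableEq m] : MOrderLE 0 (1 : Matrix m m (PDO δ)) := fun k hk => by
  rw [mcoeff_one, if_neg (by omega)]

theorem mcoeff_sum {ι : Type*} (s : Finset ι) (P : ι → Matrix l m (PDO δ)) (k : ℤ) :
    mcoeff k (∑ i ∈ s, P i) = ∑ i ∈ s, mcoeff k (P i) := by
  ext i j
  simp [mcoeff, Matrix.sum_apply, coeff_sum]

variable [Fintype m] [DecidableEq m]

theorem MOrderLE.pow {X : Matrix m m (PDO δ)} (hX : MOrderLE (-1) X) (k : ℕ) :
    MOrderLE (-k) (X ^ k) := by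
  induction k with
  | zero => simpa using morderLE_one
  | succ k ih =>
    rw [pow_succ]
    exact (ih.mul hX).mono (by push_cast; omega)

/-- The Neumann series of an operator of negative order. -/
def neumann (X : Matrix m m (PDO δ)) : Matrix m m (PDO δ) :=
  Matrix.of fun i j => of (fun k => ∑ r ∈ Finset.range (1 - k).toNat, ((X ^ r) i j).coeff k)
    ⟨0, fun k hk => by
      simp only
      rw [show (1 - k).toNat = 0 by omega]; simp⟩

theorem mcoeff_neumann (X : Matrix m m (PDO δ)) (k : ℤ) :
    mcoeff k (neumann X) = ∑ r ∈ Finset.range (1 - k).toNat, mcoeff k (X ^ r) := by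
  ext i j
  simp [mcoeff, neumann, Matrix.sum_apply]

theorem neumann_sub_order {X : Matrix m m (PDO δ)} (hX : MOrderLE (-1) X) (M : ℕ) :
    MOrderLE (-M) (neumann X - ∑ r ∈ Finset.range M, X ^ r) := by
  intro k hk
  rw [mcoeff_sub, mcoeff_neumann, mcoeff_sum, sub_eq_zero]
  refine Finset.sum_subset (fun r => by simp only [Finset.mem_range]; omega) fun r _ hr => ?_
  simp only [Finset.mem_range, not_lt] at hr
  exact hX.pow r k (by omega)

theorem one_sub_mul_neumann {X : Matrix m m (PDO δ)} (hX : MOrderLE (-1) X) :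
    (1 - X) * neumann X = 1 := by
  rw [← sub_eq_zero]
  refine eq_zero_of_forall_order fun M => ?_
  have h : (1 - X) * neumann X - 1
      = (1 - X) * (neumann X - ∑ r ∈ Finset.range M, X ^ r) - X ^ M := by
    rw [mul_sub, mul_neg_geom_sum]; abel
  rw [h]
  have h1 : MOrderLE 0 (1 - X) := morderLE_one.sub (hX.mono (by omega))
  exact ((h1.mul (neumann_sub_order hX M)).mono (by omega)).sub (hX.pow M)

theorem neumann_mul_one_sub {X : Matrix m m (PDO δ)} (hX : MOrderLE (-1) X) :
    neumann X * (1 - X) = 1 := by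
  rw [← sub_eq_zero]
  refine eq_zero_of_forall_order fun M => ?_
  have h : neumann X * (1 - X) - 1
      = (neumann X - ∑ r ∈ Finset.range M, X ^ r) * (1 - X) - X ^ M := by
    rw [sub_mul, geom_sum_mul_neg]; abel
  rw [h]
  have h1 : MOrderLE 0 (1 - X) := morderLE_one.sub (hX.mono (by omega))
  exact (((neumann_sub_order hX M).mul h1).mono (by omega)).sub (hX.pow M)

end Inverse

theorem map_derivation_mul (d : Derivation F K K) [Fintype m] (X : Matrix l m K)
    (Y : Matrix m n K) : (X * Y).map d = X.map d * Y + X * Y.map d := by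
  ext i j
  simp only [Matrix.map_apply, Matrix.mul_apply, map_sum, Derivation.leibniz, smul_eq_mul,
    Matrix.add_apply, ← Finset.sum_add_distrib]
  exact Finset.sum_congr rfl fun x _ => by ring

section Resolvent

variable [Fintype n] [DecidableEq n]

/-- The operator `(∂ - M)⁻¹ = ∑ Mᵏ ∂^{-k-1}` for a matrix `M` with constant entries. -/
def resolvent (δ : Derivation F K K) (M : Matrix n n K) : Matrix n n (PDO δ) :=
  Matrix.of fun i j => of (fun k => if k < 0 then (M ^ (-k - 1).toNat) i j else 0)
    ⟨-1, fun k hk => if_neg (by omega)⟩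

theorem mcoeff_resolvent (M : Matrix n n K) (k : ℤ) :
    mcoeff k (resolvent δ M) = if k < 0 then M ^ (-k - 1).toNat else 0 := by
  ext i j
  simp only [mcoeff, resolvent, Matrix.map_apply, Matrix.of_apply, coeff_of]
  split_ifs <;> simp

theorem morderLE_resolvent (M : Matrix n n K) : MOrderLE (-1) (resolvent δ M) := fun k hk => by
  rw [mcoeff_resolvent, if_neg (by omega)]

theorem map_derivation_pow_eq_zero {d : Derivation F K K} {M : Matrix n n K} (hM : M.map d = 0)
    (k : ℕ) : (M ^ k).map d = 0 := by
  induction k with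
  | zero =>
    ext i j
    by_cases h : i = j
    · subst h; simp
    · simp [h]
  | succ k ih => rw [pow_succ, map_derivation_mul, ih, hM]; simp

theorem map_mcoeff_resolvent {d : Derivation F K K} {M : Matrix n n K} (hM : M.map d = 0) (k : ℤ) :
    (mcoeff k (resolvent δ M)).map d = 0 := by
  rw [mcoeff_resolvent]
  split_ifs
  · exact map_derivation_pow_eq_zero hM _
  · ext i j; simp

theorem dM_mul_resolvent {M : Matrix n n K} (hM : M.map δ = 0) :
    dM δ n * resolvent δ M = resolvent δ M * dM δ n :=
  dM_mul_of_const (map_mcoeff_resolvent hM)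

theorem resolvent_mul_dM (M : Matrix n n K) :
    resolvent δ M * dM δ n = 1 + MC δ M * resolvent δ M :=
  ext_mcoeff fun k => by
    rw [mcoeff_mul_dM, mcoeff_add, mcoeff_MC_mul, mcoeff_resolvent, mcoeff_resolvent, mcoeff_one]
    rcases lt_trichotomy k 0 with h | h | h
    · rw [if_pos (by omega), if_neg (by omega), if_pos h, ← pow_succ', zero_add]
      congr 1
      omega
    · subst h; simp
    · rw [if_neg (by omega), if_neg (by omega), if_neg (by omega)]; simp

theorem resolvent_mul_MC {M : Matrix n n K} (hM : M.map δ = 0) :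
    resolvent δ M * MC δ M = MC δ M * resolvent δ M :=
  ext_mcoeff fun k => by
    rw [mcoeff_mul_MC hM, mcoeff_MC_mul, mcoeff_resolvent]
    split_ifs
    · rw [← pow_succ, ← pow_succ']
    · simp

theorem resolvent_mul_sub {M : Matrix n n K} (hM : M.map δ = 0) :
    resolvent δ M * (dM δ n - MC δ M) = 1 := by
  rw [mul_sub, resolvent_mul_dM, resolvent_mul_MC hM, add_sub_cancel_right]

theorem sub_mul_resolvent {M : Matrix n n K} (hM : M.map δ = 0) :
    (dM δ n - MC δ M) * resolvent δ M = 1 := by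
  rw [sub_mul, dM_mul_resolvent hM, resolvent_mul_dM, add_sub_cancel_right]

theorem madj_resolvent {M : Matrix n n K} (hM : M.map δ = 0) :
    madj (resolvent δ M) = -resolvent δ (-Mᵀ) := by
  have hM' : (-Mᵀ).map δ = 0 := by
    ext i j
    have := congrFun (congrFun hM j) i
    simp only [Matrix.map_apply, Matrix.zero_apply] at this
    simp [this]
  have h := congrArg madj (resolvent_mul_sub hM)
  rw [madj_mul, madj_one, madj_sub, madj_dM, madj_MC] at h
  have h2 : (dM δ n - MC δ (-Mᵀ)) * madj (resolvent δ M) = -1 := by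
    rw [← h, MC_neg, ← neg_mul]; congr 1; abel
  have h3 := congrArg (fun X => resolvent δ (-Mᵀ) * X) h2
  simpa [← mul_assoc, resolvent_mul_sub hM'] using h3

end Resolvent

end PDO

section Blocks

variable {K n : Type*} [CommRing K] [Fintype n] [DecidableEq n]

/-- The right-hand side of the Riccati equation with matrix `H`. -/
def riccatiRHS (H : Matrix (n ⊕ n) (n ⊕ n) K) (Φ : Matrix n n K) : Matrix n n K :=
  H.toBlocks₂₁ + H.toBlocks₂₂ * Φ - Φ * H.toBlocks₁₁ - Φ * H.toBlocks₁₂ * Φ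

/-- The left factor in the composition law of Riccati right-hand sides. -/
def riccatiLeft (H : Matrix (n ⊕ n) (n ⊕ n) K) (Φ : Matrix n n K) : Matrix n n K :=
  H.toBlocks₂₂ - Φ * H.toBlocks₁₂

/-- The right factor in the composition law of Riccati right-hand sides. -/
def riccatiRight (H : Matrix (n ⊕ n) (n ⊕ n) K) (Φ : Matrix n n K) : Matrix n n K :=
  H.toBlocks₁₁ + H.toBlocks₁₂ * Φ

theorem mul_eq_fromBlocks (G H : Matrix (n ⊕ n) (n ⊕ n) K) :
    G * H = Matrix.fromBlocks
      (G.toBlocks₁₁ * H.toBlocks₁₁ + G.toBlocks₁₂ * H.toBlocks₂₁)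
      (G.toBlocks₁₁ * H.toBlocks₁₂ + G.toBlocks₁₂ * H.toBlocks₂₂)
      (G.toBlocks₂₁ * H.toBlocks₁₁ + G.toBlocks₂₂ * H.toBlocks₂₁)
      (G.toBlocks₂₁ * H.toBlocks₁₂ + G.toBlocks₂₂ * H.toBlocks₂₂) := by
  rw [← Matrix.fromBlocks_multiply, Matrix.fromBlocks_toBlocks, Matrix.fromBlocks_toBlocks]

theorem riccatiRHS_mul (G H : Matrix (n ⊕ n) (n ⊕ n) K) (Φ : Matrix n n K) :
    riccatiRHS (G * H) Φ =
      riccatiRHS G Φ * riccatiRight H Φ + riccatiLeft G Φ * riccatiRHS H Φ := by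
  rw [mul_eq_fromBlocks]
  simp only [riccatiRHS, riccatiLeft, riccatiRight, Matrix.toBlocks_fromBlocks₁₁,
    Matrix.toBlocks_fromBlocks₁₂, Matrix.toBlocks_fromBlocks₂₁, Matrix.toBlocks_fromBlocks₂₂]
  noncomm_ring

theorem riccatiRight_mul (G H : Matrix (n ⊕ n) (n ⊕ n) K) (Φ : Matrix n n K) :
    riccatiRight (G * H) Φ =
      riccatiRight G Φ * riccatiRight H Φ + G.toBlocks₁₂ * riccatiRHS H Φ := by
  rw [mul_eq_fromBlocks]
  simp only [riccatiRHS, riccatiRight, Matrix.toBlocks_fromBlocks₁₁, Matrix.toBlocks_fromBlocks₁₂]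
  noncomm_ring

theorem riccatiRHS_one (Φ : Matrix n n K) : riccatiRHS 1 Φ = 0 := by
  rw [← Matrix.fromBlocks_one, riccatiRHS, Matrix.toBlocks_fromBlocks₁₁,
    Matrix.toBlocks_fromBlocks₁₂, Matrix.toBlocks_fromBlocks₂₁, Matrix.toBlocks_fromBlocks₂₂]
  simp

theorem riccatiRight_one (Φ : Matrix n n K) : riccatiRight 1 Φ = 1 := by
  rw [← Matrix.fromBlocks_one, riccatiRight, Matrix.toBlocks_fromBlocks₁₁,
    Matrix.toBlocks_fromBlocks₁₂]
  simp

variable {F : Type*} [CommRing F] [Algebra F K]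

theorem map_derivation_add {l m : Type*} (d : Derivation F K K) (X Y : Matrix l m K) :
    (X + Y).map d = X.map d + Y.map d := Matrix.map_add _ (map_add d) X Y

theorem map_derivation_sub {l m : Type*} (d : Derivation F K K) (X Y : Matrix l m K) :
    (X - Y).map d = X.map d - Y.map d := Matrix.map_sub _ (map_sub d) X Y

theorem map_toBlocks {H : Matrix (n ⊕ n) (n ⊕ n) K} {d : Derivation F K K} (hH : H.map d = 0) :
    H.toBlocks₁₁.map d = 0 ∧ H.toBlocks₁₂.map d = 0 ∧ H.toBlocks₂₁.map d = 0 ∧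
      H.toBlocks₂₂.map d = 0 :=
  ⟨by ext i j; exact congrFun (congrFun hH (.inl i)) (.inl j),
    by ext i j; exact congrFun (congrFun hH (.inl i)) (.inr j),
    by ext i j; exact congrFun (congrFun hH (.inr i)) (.inl j),
    by ext i j; exact congrFun (congrFun hH (.inr i)) (.inr j)⟩

theorem map_riccatiRHS {H : Matrix (n ⊕ n) (n ⊕ n) K} {d : Derivation F K K} (hH : H.map d = 0)
    (Φ : Matrix n n K) : (riccatiRHS H Φ).map d =
      riccatiLeft H Φ * Φ.map d - Φ.map d * riccatiRight H Φ := by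
  obtain ⟨h1, h2, h3, h4⟩ := map_toBlocks hH
  simp only [riccatiRHS, riccatiLeft, riccatiRight, map_derivation_add, map_derivation_sub,
    PDO.map_derivation_mul, h1, h2, h3, h4]
  noncomm_ring

theorem map_riccatiRight {H : Matrix (n ⊕ n) (n ⊕ n) K} {d : Derivation F K K} (hH : H.map d = 0)
    (Φ : Matrix n n K) : (riccatiRight H Φ).map d = H.toBlocks₁₂ * Φ.map d := by
  obtain ⟨h1, h2, -, -⟩ := map_toBlocks hH
  simp only [riccatiRight, map_derivation_add, PDO.map_derivation_mul, h1, h2]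
  noncomm_ring

/-- The flows of the Riccati hierarchy commute. -/
theorem map_map_comm {H : Matrix (n ⊕ n) (n ⊕ n) K} {Φ : Matrix n n K} {d e : Derivation F K K}
    {p q : ℕ} (hd : H.map d = 0) (he : H.map e = 0) (hdΦ : Φ.map d = riccatiRHS (H ^ p) Φ)
    (heΦ : Φ.map e = riccatiRHS (H ^ q) Φ) : (Φ.map e).map d = (Φ.map d).map e := by
  have h := riccatiRHS_mul (H ^ p) (H ^ q) Φ
  rw [← pow_add, add_comm, pow_add, riccatiRHS_mul] at h
  rw [hdΦ, heΦ, map_riccatiRHS (PDO.map_derivation_pow_eq_zero hd q), hdΦ,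
    map_riccatiRHS (PDO.map_derivation_pow_eq_zero he p), heΦ, sub_eq_sub_iff_add_eq_add,
    add_comm, h, add_comm]

end Blocks

namespace PDO

variable {F K : Type*} [CommRing F] [CommRing K] [Algebra F K] {δ : Derivation F K K}
variable {m n : Type*} [Fintype m] [DecidableEq m] [Fintype n] [DecidableEq n]

section Differential

/-- The projection to the differential operator part. -/
def mnonneg (P : Matrix m m (PDO δ)) : Matrix m m (PDO δ) :=
  Matrix.of fun i j => of (PsiDO.nonneg (P i j).coeff) (by
    obtain ⟨p, hp⟩ := (P i j).exists_order
    exact ⟨p, fun k hk => by simp [PsiDO.nonneg, hp k hk]⟩)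

variable {l : Type*}

/-- Matrices of differential operators. -/
def IsDifferential (P : Matrix l m (PDO δ)) : Prop := ∀ k < 0, mcoeff k P = 0

end Differential

theorem mcoeff_mnonneg (P : Matrix m m (PDO δ)) (k : ℤ) :
    mcoeff k (mnonneg P) = if 0 ≤ k then mcoeff k P else 0 := by
  ext i j
  simp only [mcoeff, mnonneg, PsiDO.nonneg, Matrix.map_apply, Matrix.of_apply, coeff_of]
  split_ifs <;> simp

theorem mnonneg_sub_eq {P E : Matrix m m (PDO δ)} (hP : IsDifferential P) (hE : MOrderLE (-1) E) :
    mnonneg (P - E) = P :=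
  ext_mcoeff fun k => by
    rw [mcoeff_mnonneg]
    split_ifs with h
    · rw [mcoeff_sub, hE k (by omega), sub_zero]
    · rw [hP k (by omega)]

section Dressing

variable (δ : Derivation F K K) (H : Matrix (n ⊕ n) (n ⊕ n) K) (Φ : Matrix n n K) (V : Matrix n m K)

/-- `Vᵀ X (∂ - R)⁻¹ V`. -/
def transfer (X : Matrix n n K) : Matrix m m (PDO δ) :=
  MC δ Vᵀ * MC δ X * resolvent δ H.toBlocks₁₁ * MC δ V

/-- The dressing operator `1 - Vᵀ Φ (∂ - R)⁻¹ V`. -/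
def dressing : Matrix m m (PDO δ) := 1 - transfer δ H V Φ

/-- The inverse of the dressing operator. -/
def dressingInv : Matrix m m (PDO δ) := neumann (transfer δ H V Φ)

/-- The dressed operator `W ∂ W⁻¹`. -/
def dressedLax : Matrix m m (PDO δ) := dressing δ H Φ V * dM δ m * dressingInv δ H Φ V

/-- Auxiliary differential operators for the positive parts of the powers of the Lax operator. -/
def auxDiff : ℕ → Matrix n m (PDO δ)
  | 0 => 0
  | k + 1 => dM δ n * auxDiff k + MC δ (riccatiRight (H ^ k) Φ) * MC δ V

/-- The differential operator part of the `k`-th power of the Lax operator. -/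
def posPart : ℕ → Matrix m m (PDO δ)
  | 0 => 1
  | k + 1 => dM δ m * posPart k + MC δ (Vᵀ * riccatiRHS (H ^ k) Φ * V)
      + MC δ (Vᵀ * riccatiRHS H Φ) * auxDiff δ H Φ V k

variable {δ H Φ V}

theorem morderLE_MC {l m : Type*} (X : Matrix l m K) : MOrderLE 0 (MC δ X) := fun k hk => by
  rw [mcoeff_MC, if_neg (by omega)]

theorem morderLE_transfer (X : Matrix n n K) : MOrderLE (-1) (transfer δ H V X) := by
  have := (((morderLE_MC (δ := δ) Vᵀ).mul (morderLE_MC X)).mul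
    (morderLE_resolvent H.toBlocks₁₁)).mul (morderLE_MC V)
  simpa [transfer] using this

theorem mcoeff_transfer (hV : V.map δ = 0) (X : Matrix n n K) (k : ℤ) :
    mcoeff k (transfer δ H V X) =
      Vᵀ * X * (if k < 0 then H.toBlocks₁₁ ^ (-k - 1).toNat else 0) * V := by
  rw [transfer, mcoeff_mul_MC hV, Matrix.mul_assoc (MC δ Vᵀ), mcoeff_MC_mul, mcoeff_MC_mul,
    mcoeff_resolvent, ← Matrix.mul_assoc]

theorem dressing_mul_inv : dressing δ H Φ V * dressingInv δ H Φ V = 1 :=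
  one_sub_mul_neumann (morderLE_transfer Φ)

theorem dressing_inv_mul : dressingInv δ H Φ V * dressing δ H Φ V = 1 :=
  neumann_mul_one_sub (morderLE_transfer Φ)

theorem morderLE_dressingInv : MOrderLE 0 (dressingInv δ H Φ V) := by
  simpa [dressingInv] using neumann_sub_order (morderLE_transfer (δ := δ) (H := H) (V := V) Φ) 0

theorem dressingInv_eq : dressingInv δ H Φ V =
    1 + transfer δ H V Φ + dressingInv δ H Φ V * transfer δ H V Φ * transfer δ H V Φ := by
  have h : dressingInv δ H Φ V = 1 + dressingInv δ H Φ V * transfer δ H V Φ := by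
    have := dressing_inv_mul (δ := δ) (H := H) (Φ := Φ) (V := V)
    rw [dressing, mul_sub, mul_one] at this
    rw [← this]; abel
  conv_lhs => rw [h, h]
  noncomm_ring

theorem mcoeff_zero_dressingInv : mcoeff 0 (dressingInv δ H Φ V) = 1 := by
  rw [dressingInv, mcoeff_neumann]
  simp [mcoeff_one]

theorem mevol_transfer {d : Derivation F K K} (hd : ∀ a, d (δ a) = δ (d a)) (hH : H.map d = 0)
    (hV : V.map d = 0) (X : Matrix n n K) :
    mevol d (transfer δ H V X) = transfer δ H V (X.map d) := by
  have hVt : Vᵀ.map d = 0 := by rw [Matrix.transpose_map, hV, Matrix.transpose_zero]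
  have hR := (map_toBlocks hH).1
  simp only [transfer, mevol_mul hd, mevol_MC, hV, hVt, mevol_of_const (map_mcoeff_resolvent hR),
    MC_zero, Matrix.zero_mul, Matrix.mul_zero, zero_add, add_zero]

theorem mevol_dressing {d : Derivation F K K} (hd : ∀ a, d (δ a) = δ (d a)) (hH : H.map d = 0)
    (hV : V.map d = 0) : mevol d (dressing δ H Φ V) = -transfer δ H V (Φ.map d) := by
  rw [dressing, mevol_sub, mevol_transfer hd hH hV, mevol_of_const, zero_sub]
  intro k
  rw [mcoeff_one]
  split_ifs
  · ext i j
    by_cases h : i = j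
    · subst h; simp
    · simp [h]
  · ext i j; simp

theorem mevol_dressingInv {d : Derivation F K K} (hd : ∀ a, d (δ a) = δ (d a)) (hH : H.map d = 0)
    (hV : V.map d = 0) : mevol d (dressingInv δ H Φ V) =
      dressingInv δ H Φ V * transfer δ H V (Φ.map d) * dressingInv δ H Φ V := by
  have h1 : mevol d (1 : Matrix m m (PDO δ)) = 0 := by
    have := mevol_dressing (δ := δ) (H := H) (Φ := 0) hd hH hV
    have h0 : (0 : Matrix n n K).map d = 0 := by ext i j; simp
    simpa [dressing, transfer, h0, MC_zero] using this
  have h2 := congrArg (mevol d) (dressing_inv_mul (δ := δ) (H := H) (Φ := Φ) (V := V))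
  rw [mevol_mul hd, mevol_dressing hd hH hV, h1] at h2
  have h3 := congrArg (fun X => X * dressingInv δ H Φ V) h2
  simp only [add_mul, mul_assoc, dressing_mul_inv, mul_one, zero_mul, mul_neg, neg_mul] at h3
  rw [mul_assoc]
  exact add_neg_eq_zero.1 h3

theorem dM_pow_mul_resolvent (hH : H.map δ = 0) (hV : V.map δ = 0) (k : ℕ) :
    dM δ n ^ k * (resolvent δ H.toBlocks₁₁ * MC δ V) =
      resolvent δ H.toBlocks₁₁ * (MC δ V * dM δ m ^ k) := by
  induction k with
  | zero => simp
  | succ k ih =>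
    rw [pow_succ', Matrix.mul_assoc, ih, ← Matrix.mul_assoc,
      dM_mul_resolvent (map_toBlocks hH).1, Matrix.mul_assoc, ← Matrix.mul_assoc (dM δ n),
      dM_mul_MC_of_const hV, Matrix.mul_assoc (MC δ V), ← pow_succ']

theorem dM_mul_resolvent_mul (hH : H.map δ = 0) {l : Type*} (Y : Matrix n l (PDO δ)) :
    dM δ n * (resolvent δ H.toBlocks₁₁ * Y) =
      Y + MC δ H.toBlocks₁₁ * (resolvent δ H.toBlocks₁₁ * Y) := by
  rw [← Matrix.mul_assoc, dM_mul_resolvent (map_toBlocks hH).1, resolvent_mul_dM, Matrix.add_mul,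
    Matrix.one_mul, Matrix.mul_assoc]

theorem dM_mul_MC_mul {p q r : Type*} [Fintype p] [DecidableEq p] [Fintype q] [DecidableEq q]
    (X : Matrix p q K) (Y : Matrix q r (PDO δ)) :
    dM δ p * (MC δ X * Y) = MC δ X * (dM δ q * Y) + MC δ (X.map δ) * Y := by
  rw [← Matrix.mul_assoc, dM_mul_MC, Matrix.add_mul, Matrix.mul_assoc]

theorem auxDiff_mul_dressing (hH : H.map δ = 0) (hQ : H.toBlocks₁₂ = V * Vᵀ)
    (hΦ : Φ.map δ = riccatiRHS H Φ) (k : ℕ) :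
    auxDiff δ H Φ V k * dressing δ H Φ V =
      (dM δ n ^ k - MC δ (riccatiRight (H ^ k) Φ)) * (resolvent δ H.toBlocks₁₁ * MC δ V) := by
  induction k with
  | zero => simp [auxDiff, riccatiRight_one, MC_one]
  | succ k ih =>
    have h1 : riccatiRight (H ^ (k + 1)) Φ = riccatiRight (H ^ k) Φ * H.toBlocks₁₁ +
        riccatiRight (H ^ k) Φ * (V * (Vᵀ * Φ)) + (riccatiRight (H ^ k) Φ).map δ := by
      rw [map_riccatiRight (map_derivation_pow_eq_zero hH k), hΦ, pow_succ, riccatiRight_mul]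
      simp only [riccatiRight, hQ, Matrix.mul_add, Matrix.mul_assoc]
    rw [auxDiff, Matrix.add_mul, Matrix.mul_assoc, ih, h1, pow_succ']
    simp only [dressing, transfer, MC_add, MC_mul, Matrix.mul_add, Matrix.mul_sub, Matrix.sub_mul,
      Matrix.add_mul, Matrix.mul_assoc, dM_mul_MC_mul, dM_mul_resolvent_mul hH, Matrix.mul_one]
    abel

theorem posPart_mul_dressing (hH : H.map δ = 0) (hV : V.map δ = 0) (hQ : H.toBlocks₁₂ = V * Vᵀ)
    (hΦ : Φ.map δ = riccatiRHS H Φ) (k : ℕ) :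
    posPart δ H Φ V k * dressing δ H Φ V =
      dressing δ H Φ V * dM δ m ^ k - transfer δ H V (riccatiRHS (H ^ k) Φ) := by
  induction k with
  | zero => simp [posPart, riccatiRHS_one, transfer, MC_zero]
  | succ k ih =>
    have hVt : Vᵀ.map δ = 0 := by rw [Matrix.transpose_map, hV, Matrix.transpose_zero]
    have h1 : riccatiRHS (H ^ (k + 1)) Φ = riccatiRHS (H ^ k) Φ * H.toBlocks₁₁ +
        riccatiRHS (H ^ k) Φ * (V * (Vᵀ * Φ)) + (riccatiRHS (H ^ k) Φ).map δ +
        riccatiRHS H Φ * riccatiRight (H ^ k) Φ := by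
      rw [map_riccatiRHS (map_derivation_pow_eq_zero hH k), hΦ, pow_succ, riccatiRHS_mul]
      simp only [riccatiRight, hQ, Matrix.mul_add, Matrix.mul_assoc]
      abel
    have hc : resolvent δ H.toBlocks₁₁ * (MC δ V * (dM δ m * dM δ m ^ k)) = MC δ V * dM δ m ^ k +
        MC δ H.toBlocks₁₁ * (resolvent δ H.toBlocks₁₁ * (MC δ V * dM δ m ^ k)) := by
      rw [← Matrix.mul_assoc (MC δ V), ← dM_mul_MC_of_const hV, Matrix.mul_assoc (dM δ n),
        ← Matrix.mul_assoc, ← dM_mul_resolvent (map_toBlocks hH).1, Matrix.mul_assoc,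
        dM_mul_resolvent_mul hH]
    rw [posPart, Matrix.add_mul, Matrix.add_mul, Matrix.mul_assoc, ih,
      Matrix.mul_assoc (MC δ (Vᵀ * riccatiRHS H Φ)) (auxDiff δ H Φ V k),
      auxDiff_mul_dressing hH hQ hΦ, h1, pow_succ']
    simp only [dressing, transfer, MC_add, MC_mul, Matrix.mul_add, Matrix.mul_sub, Matrix.sub_mul,
      Matrix.add_mul, Matrix.mul_assoc, dM_mul_MC_mul, dM_mul_resolvent_mul hH, Matrix.mul_one,
      Matrix.one_mul, hVt, hΦ, MC_zero, Matrix.zero_mul, dM_pow_mul_resolvent hH hV,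
      hc, add_zero]
    abel

theorem isDifferential_auxDiff (k : ℕ) : IsDifferential (auxDiff δ H Φ V k) := by
  induction k with
  | zero => intro j _; rfl
  | succ k ih =>
    intro j hj
    rw [auxDiff, mcoeff_add, mcoeff_dM_mul, ih _ (by omega), ih _ hj, mcoeff_MC_mul, mcoeff_MC,
      if_neg (by omega)]
    ext a b; simp

theorem isDifferential_posPart (k : ℕ) : IsDifferential (posPart δ H Φ V k) := by
  induction k with
  | zero => intro j hj; rw [posPart, mcoeff_one, if_neg (by omega)]
  | succ k ih =>
    intro j hj
    rw [posPart, mcoeff_add, mcoeff_add, mcoeff_dM_mul, ih _ (by omega), ih _ hj, mcoeff_MC_mul,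
      isDifferential_auxDiff _ _ hj, mcoeff_MC, if_neg (by omega)]
    ext a b; simp

theorem dressedLax_pow (k : ℕ) : dressedLax δ H Φ V ^ k =
    dressing δ H Φ V * dM δ m ^ k * dressingInv δ H Φ V := by
  induction k with
  | zero => simp [dressing_mul_inv]
  | succ k ih =>
    rw [pow_succ, ih, dressedLax, pow_succ]
    simp only [mul_assoc]
    rw [← mul_assoc (dressingInv δ H Φ V), dressing_inv_mul, one_mul]

theorem dressedLax_pow_eq (hH : H.map δ = 0) (hV : V.map δ = 0) (hQ : H.toBlocks₁₂ = V * Vᵀ)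
    (hΦ : Φ.map δ = riccatiRHS H Φ) (k : ℕ) : dressedLax δ H Φ V ^ k =
      posPart δ H Φ V k + transfer δ H V (riccatiRHS (H ^ k) Φ) * dressingInv δ H Φ V := by
  have h := posPart_mul_dressing hH hV hQ hΦ k
  rw [dressedLax_pow, ← sub_eq_iff_eq_add, ← sub_mul, ← h, mul_assoc, dressing_mul_inv, mul_one]

theorem dressedLax_eq (hH : H.map δ = 0) (hV : V.map δ = 0) (hQ : H.toBlocks₁₂ = V * Vᵀ)
    (hΦ : Φ.map δ = riccatiRHS H Φ) : dressedLax δ H Φ V =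
      dM δ m + transfer δ H V (riccatiRHS H Φ) * dressingInv δ H Φ V := by
  have h := dressedLax_pow_eq hH hV hQ hΦ 1
  simpa [posPart, auxDiff, riccatiRHS_one, MC_zero] using h

theorem mnonneg_dressedLax_pow (hH : H.map δ = 0) (hV : V.map δ = 0) (hQ : H.toBlocks₁₂ = V * Vᵀ)
    (hΦ : Φ.map δ = riccatiRHS H Φ) (k : ℕ) :
    mnonneg (dressedLax δ H Φ V ^ k) = posPart δ H Φ V k := by
  rw [dressedLax_pow_eq hH hV hQ hΦ, ← sub_neg_eq_add]
  refine mnonneg_sub_eq (isDifferential_posPart k) (MOrderLE.neg ?_)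
  simpa using (morderLE_transfer (riccatiRHS (H ^ k) Φ)).mul (morderLE_dressingInv (δ := δ))

/-- The residues of the powers of the Lax operator. -/
theorem mcoeff_neg_one_dressedLax_pow (hH : H.map δ = 0) (hV : V.map δ = 0)
    (hQ : H.toBlocks₁₂ = V * Vᵀ) (hΦ : Φ.map δ = riccatiRHS H Φ) (k : ℕ) :
    mcoeff (-1) (dressedLax δ H Φ V ^ k) = Vᵀ * riccatiRHS (H ^ k) Φ * V := by
  have h := mcoeff_mul_leading (morderLE_transfer (δ := δ) (H := H) (V := V)
    (riccatiRHS (H ^ k) Φ)) (morderLE_dressingInv (δ := δ) (H := H) (Φ := Φ) (V := V))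
  rw [add_zero, mcoeff_zero_dressingInv, mcoeff_transfer hV] at h
  rw [dressedLax_pow_eq hH hV hQ hΦ, mcoeff_add, isDifferential_posPart k _ (by omega), h]
  simp

theorem mcoeff_dressedLax_of_nonneg (hH : H.map δ = 0) (hV : V.map δ = 0)
    (hQ : H.toBlocks₁₂ = V * Vᵀ) (hΦ : Φ.map δ = riccatiRHS H Φ) {k : ℤ} (hk : 0 ≤ k) :
    mcoeff k (dressedLax δ H Φ V) = if k = 1 then 1 else 0 := by
  have h : MOrderLE (-1) (transfer δ H V (riccatiRHS H Φ) * dressingInv δ H Φ V) := by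
    simpa using (morderLE_transfer (riccatiRHS H Φ)).mul (morderLE_dressingInv (δ := δ))
  rw [dressedLax_eq hH hV hQ hΦ, mcoeff_add, mcoeff_dM, h k (by omega), add_zero]

theorem mcoeff_neg_two_dressedLax (hH : H.map δ = 0) (hV : V.map δ = 0)
    (hQ : H.toBlocks₁₂ = V * Vᵀ) (hΦ : Φ.map δ = riccatiRHS H Φ) :
    mcoeff (-2) (dressedLax δ H Φ V) = Vᵀ * (riccatiRHS H Φ * riccatiRight H Φ) * V := by
  have h1 := morderLE_transfer (δ := δ) (H := H) (V := V) (riccatiRHS H Φ)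
  have h2 := morderLE_transfer (δ := δ) (H := H) (V := V) Φ
  have h3 := mcoeff_mul_leading h1 h2
  have h4 := h1.mul (((morderLE_dressingInv (δ := δ) (H := H) (Φ := Φ) (V := V)).mul h2).mul h2)
  rw [dressedLax_eq hH hV hQ hΦ, dressingInv_eq, mul_add, mul_add, mul_one, mcoeff_add, mcoeff_add,
    mcoeff_add, mcoeff_dM, h4 (-2) (by omega), show (-2 : ℤ) = -1 + -1 by norm_num, h3,
    mcoeff_transfer hV, mcoeff_transfer hV, mcoeff_transfer hV, riccatiRight, hQ]
  simp [Matrix.mul_add, Matrix.add_mul, Matrix.mul_assoc]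

/-- The Lax equations. -/
theorem mevol_dressedLax {d : Derivation F K K} (hd : ∀ a, d (δ a) = δ (d a)) (hH : H.map δ = 0)
    (hV : V.map δ = 0) (hQ : H.toBlocks₁₂ = V * Vᵀ) (hΦ : Φ.map δ = riccatiRHS H Φ)
    (hHd : H.map d = 0) (hVd : V.map d = 0) {k : ℕ} (hΦd : Φ.map d = riccatiRHS (H ^ k) Φ) :
    mevol d (dressedLax δ H Φ V) =
      mnonneg (dressedLax δ H Φ V ^ k) * dressedLax δ H Φ V -
        dressedLax δ H Φ V * mnonneg (dressedLax δ H Φ V ^ k) := by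
  have h1 : mevol d (dM δ m) = 0 := mevol_of_const fun j => by
    rw [mcoeff_dM]
    ext a b
    by_cases h : a = b
    · subst h; split_ifs <;> simp
    · split_ifs <;> simp [h]
  have h2 := dressedLax_pow_eq hH hV hQ hΦ k
  have h3 : mnonneg (dressedLax δ H Φ V ^ k) = dressedLax δ H Φ V ^ k -
      transfer δ H V (riccatiRHS (H ^ k) Φ) * dressingInv δ H Φ V := by
    rw [mnonneg_dressedLax_pow hH hV hQ hΦ, h2, add_sub_cancel_right]
  rw [h3, sub_mul, mul_sub, ← pow_succ, ← pow_succ', dressedLax, mevol_mul hd, mevol_mul hd, h1,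
    mevol_dressing hd hHd hVd, mevol_dressingInv hd hHd hVd, hΦd]
  simp only [mul_assoc, neg_mul, mul_zero, add_zero]
  rw [← mul_assoc (dressingInv δ H Φ V) (dressing δ H Φ V), dressing_inv_mul, one_mul]
  abel

theorem conj_eq_neg {A : Type*} [Ring A] {a b r l φ q s : A} (ha : a * r = 1) (hb : l * b = 1)
    (h : φ * a - b * φ - φ * q * φ + s = 0) :
    l * φ - φ * r - l * φ * q * φ * r = -(l * s * r) := by
  have h' := congrArg (fun x => l * x * r) h
  simp only [mul_add, mul_sub, add_mul, sub_mul, mul_zero, zero_mul] at h'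
  rw [← mul_assoc l φ a, mul_assoc (l * φ) a r, ha, mul_one, ← mul_assoc l b φ, hb, one_mul] at h'
  rw [eq_neg_iff_add_eq_zero, ← h']
  simp only [mul_assoc]

/-- The Lax operator of a symmetric solution is skew-adjoint. -/
theorem madj_dressedLax (hH : H.map δ = 0) (hV : V.map δ = 0) (hQ : H.toBlocks₁₂ = V * Vᵀ)
    (hR : H.toBlocks₁₁ = -H.toBlocks₂₂ᵀ) (hΦ : Φ.map δ = riccatiRHS H Φ) (hsymm : Φᵀ = Φ) :
    madj (dressedLax δ H Φ V) = -dressedLax δ H Φ V := by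
  obtain ⟨h11, -, h21, h22⟩ := map_toBlocks hH
  have hVt : Vᵀ.map δ = 0 := by rw [Matrix.transpose_map, hV, Matrix.transpose_zero]
  have hL : -H.toBlocks₁₁ᵀ = H.toBlocks₂₂ := by rw [hR]; simp
  have hW : madj (dressing δ H Φ V) =
      1 + MC δ Vᵀ * (resolvent δ H.toBlocks₂₂ * (MC δ Φ * MC δ V)) := by
    rw [dressing, transfer, madj_sub, madj_one, madj_mul, madj_mul, madj_mul, madj_MC, madj_MC,
      madj_MC, madj_resolvent h11, hL, hsymm, Matrix.transpose_transpose]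
    simp
  have hWW : madj (dressing δ H Φ V) * dressing δ H Φ V =
      1 - MC δ Vᵀ * (resolvent δ H.toBlocks₂₂ * (MC δ H.toBlocks₂₁ *
        (resolvent δ H.toBlocks₁₁ * MC δ V))) := by
    have e : resolvent δ H.toBlocks₂₂ * MC δ Φ - MC δ Φ * resolvent δ H.toBlocks₁₁ -
        resolvent δ H.toBlocks₂₂ * MC δ Φ * MC δ (V * Vᵀ) * MC δ Φ * resolvent δ H.toBlocks₁₁ =
        -(resolvent δ H.toBlocks₂₂ * MC δ H.toBlocks₂₁ * resolvent δ H.toBlocks₁₁) := by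
      refine conj_eq_neg (sub_mul_resolvent h11) (resolvent_mul_sub h22) ?_
      rw [mul_sub, sub_mul, dM_mul_MC, hΦ, riccatiRHS, ← hQ]
      simp only [MC_add, MC_sub, MC_mul]
      abel
    have e' := congrArg (fun X => MC δ Vᵀ * X * MC δ V) e
    simp only [MC_mul, Matrix.mul_sub, Matrix.sub_mul, Matrix.mul_assoc, Matrix.mul_neg,
      Matrix.neg_mul] at e'
    rw [hW, dressing, transfer, sub_eq_add_neg (1 : Matrix m m (PDO δ)) (MC δ Vᵀ * _), ← e']
    simp only [Matrix.mul_sub, Matrix.add_mul, Matrix.mul_assoc, Matrix.one_mul, Matrix.mul_one]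
    abel
  have hcomm : dM δ m * (madj (dressing δ H Φ V) * dressing δ H Φ V) =
      madj (dressing δ H Φ V) * dressing δ H Φ V * dM δ m := by
    have hr1 : ∀ Y : Matrix n m (PDO δ), dM δ n * (resolvent δ H.toBlocks₁₁ * Y) =
        resolvent δ H.toBlocks₁₁ * (dM δ n * Y) := fun Y => by
      rw [← Matrix.mul_assoc, dM_mul_resolvent h11, Matrix.mul_assoc]
    have hr2 : ∀ Y : Matrix n m (PDO δ), dM δ n * (resolvent δ H.toBlocks₂₂ * Y) =
        resolvent δ H.toBlocks₂₂ * (dM δ n * Y) := fun Y => by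
      rw [← Matrix.mul_assoc, dM_mul_resolvent h22, Matrix.mul_assoc]
    rw [hWW]
    simp only [Matrix.mul_sub, Matrix.sub_mul, Matrix.mul_one, Matrix.one_mul, dM_mul_MC_mul, hVt,
      h21, hr1, hr2, dM_mul_MC_of_const hV, MC_zero, Matrix.zero_mul, add_zero, Matrix.mul_assoc]
  have hinv : madj (dressing δ H Φ V) * madj (dressingInv δ H Φ V) = 1 := by
    rw [← madj_mul, dressing_inv_mul, madj_one]
  have hinv' : madj (dressingInv δ H Φ V) * madj (dressing δ H Φ V) = 1 := by
    rw [← madj_mul, dressing_mul_inv, madj_one]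
  have key : dM δ m * madj (dressing δ H Φ V) =
      madj (dressing δ H Φ V) * dressedLax δ H Φ V := by
    have := congrArg (fun X => X * dressingInv δ H Φ V) hcomm
    simpa only [mul_assoc, dressing_mul_inv, mul_one, dressedLax] using this
  rw [dressedLax, madj_mul, madj_mul, madj_dM, neg_mul, mul_neg, key, ← mul_assoc, hinv', one_mul,
    dressedLax]

end Dressing

end PDO

namespace OddTimes

variable {𝕜 𝕂 : Type*} [RCLike 𝕜] [RCLike 𝕂] [NormedAlgebra 𝕜 𝕂] {ι κ l : Type*}
  {Ω : Set (OddTimes 𝕜)}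

theorem setFirst_self (t : OddTimes 𝕜) (n : ℕ) : t.setFirst n (fun k => t k) = t := by
  funext k; simp [setFirst]

theorem setFirst_update (t : OddTimes 𝕜) (k : ℕ) (s : 𝕜) :
    t.setFirst (k + 1) (Function.update (fun i : Fin (k + 1) => t i) (Fin.last k) s) =
      Function.update t k s := by
  funext j
  simp only [setFirst, Function.update_apply, Fin.ext_iff, Fin.val_last]
  split_ifs with h1 h2 h2 <;> first | rfl | omega

theorem IsDomain.isOpen_line (hΩ : IsDomain Ω) (t : OddTimes 𝕜) (k : ℕ) :
    IsOpen {s : 𝕜 | Function.update t k s ∈ Ω} := by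
  have h : Continuous fun s : 𝕜 => Function.update (fun i : Fin (k + 1) => t i) (Fin.last k) s :=
    continuous_const.update _ continuous_id
  simpa only [Set.preimage_ofPred_eq, setFirst_update] using (hΩ t (k + 1)).preimage h

theorem IsDomain.eventually_line (hΩ : IsDomain Ω) {t : OddTimes 𝕜} (ht : t ∈ Ω) (k : ℕ) :
    ∀ᶠ s in nhds (t k), Function.update t k s ∈ Ω :=
  (hΩ.isOpen_line t k).mem_nhds (by simpa using ht)

theorem IsDomain.eventually_first (hΩ : IsDomain Ω) {t : OddTimes 𝕜} (ht : t ∈ Ω) (n : ℕ) :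
    ∀ᶠ s in nhds (fun k : Fin n => t k), t.setFirst n s ∈ Ω :=
  (hΩ t n).mem_nhds (by simpa [setFirst_self] using ht)

theorem differentiableAt_line {f : OddTimes 𝕜 → 𝕂} {t : OddTimes 𝕜} {k : ℕ}
    (h : ContDiffAt 𝕜 ∞ (fun s : Fin (k + 1) → 𝕜 => f (t.setFirst (k + 1) s)) fun i => t i) :
    DifferentiableAt 𝕜 (fun s => f (Function.update t k s)) (t k) := by
  have h1 : DifferentiableAt 𝕜
      (fun s : 𝕜 => Function.update (fun i : Fin (k + 1) => t i) (Fin.last k) s) (t k) :=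
    (hasDerivAt_update _ _ _).differentiableAt
  have h2 := h.differentiableAt (by simp)
  have h3 : (fun i : Fin (k + 1) => t i) =
      Function.update (fun i : Fin (k + 1) => t i) (Fin.last k) (t k) := by
    rw [eq_comm, Function.update_eq_self_iff]; simp
  rw [h3] at h2
  simpa only [Function.comp_def, setFirst_update] using h2.comp (t k) h1

section MatrixDerivative

/-- `f` has the entrywise partial derivative `f'` with respect to `t_{2k+1}` at `t`. -/
def HasPartialDerivAt (k : ℕ) (f : OddTimes 𝕜 → Matrix ι κ 𝕂) (f' : Matrix ι κ 𝕂)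
    (t : OddTimes 𝕜) : Prop :=
  ∀ i j, HasDerivAt (fun s => f (Function.update t k s) i j) (f' i j) (t k)

variable {k : ℕ} {f g : OddTimes 𝕜 → Matrix ι κ 𝕂} {f' g' : Matrix ι κ 𝕂} {t : OddTimes 𝕜}

theorem HasPartialDerivAt.pd_eq (h : HasPartialDerivAt k f f' t) : pd k f t = f' := by
  ext i j; exact (h i j).deriv

theorem SmoothOn.hasPartialDerivAt (hf : SmoothOn Ω f) (ht : t ∈ Ω) (k : ℕ) :
    HasPartialDerivAt k f (pd k f t) t := fun i j =>
  (differentiableAt_line (f := fun t => f t i j) (hf t ht (k + 1) i j)).hasDerivAt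

theorem HasPartialDerivAt.add (hf : HasPartialDerivAt k f f' t) (hg : HasPartialDerivAt k g g' t) :
    HasPartialDerivAt k (fun t => f t + g t) (f' + g') t := fun i j => (hf i j).add (hg i j)

theorem HasPartialDerivAt.sub (hf : HasPartialDerivAt k f f' t) (hg : HasPartialDerivAt k g g' t) :
    HasPartialDerivAt k (fun t => f t - g t) (f' - g') t := fun i j => (hf i j).sub (hg i j)

theorem HasPartialDerivAt.smul (hf : HasPartialDerivAt k f f' t) (c : 𝕂) :
    HasPartialDerivAt k (fun t => c • f t) (c • f') t := fun i j => (hf i j).const_mul c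

theorem HasPartialDerivAt.const_mul [Fintype ι] (hf : HasPartialDerivAt k f f' t)
    (A : Matrix l ι 𝕂) : HasPartialDerivAt k (fun t => A * f t) (A * f') t := fun i j => by
  simp only [Matrix.mul_apply]
  exact HasDerivAt.fun_sum fun x _ => (hf x j).const_mul (A i x)

theorem HasPartialDerivAt.mul_const [Fintype κ] (hf : HasPartialDerivAt k f f' t)
    (A : Matrix κ l 𝕂) : HasPartialDerivAt k (fun t => f t * A) (f' * A) t := fun i j => by
  simp only [Matrix.mul_apply]
  exact HasDerivAt.fun_sum fun x _ => (hf i x).mul_const (A x j)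

theorem SmoothOn.add (hf : SmoothOn Ω f) (hg : SmoothOn Ω g) :
    SmoothOn Ω (fun t => f t + g t) := fun t ht n i j => (hf t ht n i j).add (hg t ht n i j)

theorem SmoothOn.sub (hf : SmoothOn Ω f) (hg : SmoothOn Ω g) :
    SmoothOn Ω (fun t => f t - g t) := fun t ht n i j => (hf t ht n i j).sub (hg t ht n i j)

theorem SmoothOn.smul (hf : SmoothOn Ω f) (c : 𝕂) :
    SmoothOn Ω (fun t => c • f t) := fun t ht n i j => contDiffAt_const.mul (hf t ht n i j)

theorem SmoothOn.const_mul [Fintype ι] (hf : SmoothOn Ω f) (A : Matrix l ι 𝕂) :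
    SmoothOn Ω (fun t => A * f t) := fun t ht n i j => by
  simp only [Matrix.mul_apply]
  exact ContDiffAt.sum fun x _ => contDiffAt_const.mul (hf t ht n x j)

theorem SmoothOn.mul_const [Fintype κ] (hf : SmoothOn Ω f) (A : Matrix κ l 𝕂) :
    SmoothOn Ω (fun t => f t * A) := fun t ht n i j => by
  simp only [Matrix.mul_apply]
  exact ContDiffAt.sum fun x _ => (hf t ht n i x).mul contDiffAt_const

end MatrixDerivative

section Functions

open Classical in
/-- Extension by zero of a function on `Ω`. -/
def extendZero (f : Ω → 𝕂) (t : OddTimes 𝕜) : 𝕂 := if h : t ∈ Ω then f ⟨t, h⟩ else 0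

theorem extendZero_of_mem (f : Ω → 𝕂) {t : OddTimes 𝕜} (ht : t ∈ Ω) :
    extendZero f t = f ⟨t, ht⟩ := dif_pos ht

theorem extendZero_add (f g : Ω → 𝕂) (t : OddTimes 𝕜) :
    extendZero (f + g) t = extendZero f t + extendZero g t := by
  unfold extendZero; split_ifs <;> simp

theorem extendZero_mul (f g : Ω → 𝕂) (t : OddTimes 𝕜) :
    extendZero (f * g) t = extendZero f t * extendZero g t := by
  unfold extendZero; split_ifs <;> simp

/-- `g` is the partial derivative of `f` with respect to `t_{2k+1}` on `Ω`. -/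
def HasPartialDeriv (k : ℕ) (f g : Ω → 𝕂) : Prop :=
  ∀ t : Ω, HasDerivAt (fun s : 𝕜 => extendZero f (Function.update t.1 k s)) (g t) (t.1 k)

/-- Scalar functions on `Ω` that are smooth in each finite collection of the variables. -/
def IsSmooth (f : Ω → 𝕂) : Prop :=
  ∀ t ∈ Ω, ∀ n : ℕ,
    ContDiffAt 𝕜 ∞ (fun s : Fin n → 𝕜 => extendZero f (t.setFirst n s)) (fun k => t k)

theorem HasPartialDeriv.unique {k : ℕ} {f g h : Ω → 𝕂} (hg : HasPartialDeriv k f g)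
    (hh : HasPartialDeriv k f h) : g = h := funext fun t => (hg t).unique (hh t)

theorem HasPartialDeriv.add {k : ℕ} {f g f' g' : Ω → 𝕂} (hf : HasPartialDeriv k f f')
    (hg : HasPartialDeriv k g g') : HasPartialDeriv k (f + g) (f' + g') := fun t => by
  simp only [extendZero_add]
  exact (hf t).add (hg t)

theorem HasPartialDeriv.mul {k : ℕ} {f g f' g' : Ω → 𝕂} (hf : HasPartialDeriv k f f')
    (hg : HasPartialDeriv k g g') : HasPartialDeriv k (f * g) (f' * g + f * g') := fun t => by
  simp only [extendZero_mul]
  have h := (hf t).fun_mul (hg t)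
  simp only [Function.update_eq_self, extendZero_of_mem _ t.2] at h
  exact h

theorem hasPartialDeriv_const (hΩ : IsDomain Ω) (k : ℕ) (c : 𝕂) :
    HasPartialDeriv k (algebraMap 𝕂 (Ω → 𝕂) c) 0 := fun t => by
  refine (hasDerivAt_const (t.1 k) c).congr_of_eventuallyEq ?_
  filter_upwards [hΩ.eventually_line t.2 k] with s hs
  rw [extendZero_of_mem _ hs]; rfl

theorem IsSmooth.add {f g : Ω → 𝕂} (hf : IsSmooth f) (hg : IsSmooth g) : IsSmooth (f + g) :=
  fun t ht n => by
    simp only [extendZero_add]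
    exact (hf t ht n).add (hg t ht n)

theorem IsSmooth.mul {f g : Ω → 𝕂} (hf : IsSmooth f) (hg : IsSmooth g) : IsSmooth (f * g) :=
  fun t ht n => by
    simp only [extendZero_mul]
    exact (hf t ht n).mul (hg t ht n)

theorem isSmooth_const (hΩ : IsDomain Ω) (c : 𝕂) : IsSmooth (algebraMap 𝕂 (Ω → 𝕂) c) :=
  fun t ht n => by
    refine (contDiffAt_const (c := c)).congr_of_eventuallyEq ?_
    filter_upwards [hΩ.eventually_first ht n] with s hs
    rw [extendZero_of_mem _ hs]; rfl

/-- A differential algebra of functions on `Ω`, closed under all partial derivatives. -/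
def IsDiffClosed (A : Subalgebra 𝕂 (Ω → 𝕂)) : Prop :=
  ∀ k, ∀ f ∈ A, ∃ g ∈ A, HasPartialDeriv k f g

/-- The partial derivative with respect to `t_{2k+1}` as a derivation. -/
def partialDeriv (hΩ : IsDomain Ω) {A : Subalgebra 𝕂 (Ω → 𝕂)} (hA : IsDiffClosed A) (k : ℕ) :
    Derivation 𝕂 A A :=
  have spec (f : A) : HasPartialDeriv k f.1 (hA k f.1 f.2).choose :=
    (hA k f.1 f.2).choose_spec.2
  Derivation.mk'
    { toFun f := ⟨(hA k f.1 f.2).choose, (hA k f.1 f.2).choose_spec.1⟩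
      map_add' f g := Subtype.ext ((spec (f + g)).unique ((spec f).add (spec g)))
      map_smul' c f := Subtype.ext ((spec (c • f)).unique (by
        have := (hasPartialDeriv_const hΩ k c).mul (spec f)
        rw [zero_mul, zero_add, ← Algebra.smul_def, ← Algebra.smul_def] at this
        exact this)) }
    fun f g => Subtype.ext ((spec (f * g)).unique (by
      have h := (spec f).mul (spec g)
      rw [add_comm, mul_comm (hA k f.1 f.2).choose g.1] at h
      exact h))

theorem hasPartialDeriv_partialDeriv (hΩ : IsDomain Ω) {A : Subalgebra 𝕂 (Ω → 𝕂)}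
    (hA : IsDiffClosed A) (k : ℕ) (f : A) :
    HasPartialDeriv k f.1 (partialDeriv hΩ hA k f).1 :=
  (hA k f.1 f.2).choose_spec.2

theorem HasPartialDeriv.partialDeriv_eq (hΩ : IsDomain Ω) {A : Subalgebra 𝕂 (Ω → 𝕂)}
    (hA : IsDiffClosed A) {k : ℕ} {f g : A} (h : HasPartialDeriv k f.1 g.1) :
    partialDeriv hΩ hA k f = g :=
  Subtype.ext ((hasPartialDeriv_partialDeriv hΩ hA k f).unique h)

/-- Evaluation at a point. -/
def evalAt (A : Subalgebra 𝕂 (Ω → 𝕂)) (t : Ω) : A →ₐ[𝕂] 𝕂 :=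
  (Pi.evalAlgHom 𝕂 (fun _ : Ω => 𝕂) t).comp A.val

/-- The matrix function `f` is represented on `Ω` by the matrix `X` over `A`. -/
def Represents {A : Subalgebra 𝕂 (Ω → 𝕂)} (f : OddTimes 𝕜 → Matrix ι κ 𝕂) (X : Matrix ι κ A) :
    Prop := ∀ t : Ω, f t.1 = X.map (evalAt A t)

theorem Represents.pd {hΩ : IsDomain Ω} {A : Subalgebra 𝕂 (Ω → 𝕂)} {hA : IsDiffClosed A}
    {f : OddTimes 𝕜 → Matrix ι κ 𝕂} {X : Matrix ι κ A} (h : Represents f X) (k : ℕ) :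
    Represents (pd k f) (X.map (partialDeriv hΩ hA k)) := fun t => by
  refine HasPartialDerivAt.pd_eq fun i j => ?_
  refine (hasPartialDeriv_partialDeriv hΩ hA k (X i j) t).congr_of_eventuallyEq ?_
  filter_upwards [hΩ.eventually_line t.2 k] with s hs
  rw [extendZero_of_mem _ hs, h ⟨_, hs⟩]; rfl

theorem Represents.iterate_pd {hΩ : IsDomain Ω} {A : Subalgebra 𝕂 (Ω → 𝕂)} {hA : IsDiffClosed A}
    {f : OddTimes 𝕜 → Matrix ι κ 𝕂} {X : Matrix ι κ A} (h : Represents f X) (k r : ℕ) :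
    Represents ((OddTimes.pd k)^[r] f) (X.map (partialDeriv hΩ hA k)^[r]) := by
  induction r with
  | zero => simpa using h
  | succ r ih =>
    rw [Function.iterate_succ_apply']
    have := ih.pd (hΩ := hΩ) (hA := hA) k
    rwa [Matrix.map_map, ← Function.iterate_succ'] at this

theorem pd_zero (k : ℕ) : pd k (0 : OddTimes 𝕜 → Matrix ι κ 𝕂) = 0 := by
  funext t; ext i j; simp [pd]

end Functions

section Operators

variable [Fintype ι] [DecidableEq ι]
variable {hΩ : IsDomain Ω} {A : Subalgebra 𝕂 (Ω → 𝕂)} {hA : IsDiffClosed A}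

/-- The coefficients of the operator `P` are represented on `Ω` by those of `M`. -/
def RepresentsOp (hΩ : IsDomain Ω) (hA : IsDiffClosed A) (P : ℤ → OddTimes 𝕜 → Matrix ι ι 𝕂)
    (M : Matrix ι ι (PDO (partialDeriv hΩ hA 0))) : Prop :=
  (∃ p, OrderLE p P) ∧ ∀ n, Represents (P n) (PDO.mcoeff n M)

theorem RepresentsOp.mul {P Q : ℤ → OddTimes 𝕜 → Matrix ι ι 𝕂}
    {M N : Matrix ι ι (PDO (partialDeriv hΩ hA 0))} (hP : RepresentsOp hΩ hA P M)
    (hQ : RepresentsOp hΩ hA Q N) : RepresentsOp hΩ hA (PsiDO.mul (pd 0) P Q) (M * N) := by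
  obtain ⟨⟨p, hp⟩, hP⟩ := hP
  obtain ⟨⟨q, hq⟩, hQ⟩ := hQ
  refine ⟨⟨_, hp.mul (pd_zero 0) hq⟩, fun n t => ?_⟩
  obtain ⟨p', hp'⟩ := PDO.exists_morderLE M
  obtain ⟨q', hq'⟩ := PDO.exists_morderLE N
  rw [PsiDO.mul_eq_sum (pd_zero 0) (hp.mono (le_max_left p p')) (hq.mono (le_max_left q q')) n
    subset_rfl]
  ext i j
  simp only [PDO.mcoeff, Matrix.map_apply, Matrix.mul_apply, PDO.coeff_sum, map_sum]
  have h (x : ι) := PDO.coeff_mul_eq_sum ((hp'.mono (le_max_right p p')).entry i x)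
    ((hq'.mono (le_max_right q q')).entry x j) n subset_rfl
  simp only [h, map_sum]
  rw [Finset.sum_comm, Finset.sum_apply, Matrix.sum_apply]
  refine Finset.sum_congr rfl fun y _ => ?_
  have h1 := hP y.1 t
  have h2 := (hQ (n - y.1 + y.2)).iterate_pd (hΩ := hΩ) (hA := hA) 0 y.2 t
  simp only [Pi.smul_apply, Pi.mul_apply, Matrix.smul_apply, h1, h2, Matrix.mul_apply,
    Finset.smul_sum, map_zsmul, map_mul]
  rfl

theorem RepresentsOp.sub {P Q : ℤ → OddTimes 𝕜 → Matrix ι ι 𝕂}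
    {M N : Matrix ι ι (PDO (partialDeriv hΩ hA 0))} (hP : RepresentsOp hΩ hA P M)
    (hQ : RepresentsOp hΩ hA Q N) : RepresentsOp hΩ hA (fun n => P n - Q n) (M - N) := by
  obtain ⟨⟨p, hp⟩, hP⟩ := hP
  obtain ⟨⟨q, hq⟩, hQ⟩ := hQ
  refine ⟨⟨max p q, fun i hi => by simp [hp i (by omega), hq i (by omega)]⟩, fun n t => ?_⟩
  change P n t.1 - Q n t.1 = _
  rw [hP n t, hQ n t, PDO.mcoeff_sub]
  ext i j; simp

theorem RepresentsOp.one :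
    RepresentsOp hΩ hA (PsiDO.one : ℤ → OddTimes 𝕜 → Matrix ι ι 𝕂) 1 := by
  refine ⟨⟨0, fun i hi => if_neg (by omega)⟩, fun n t => ?_⟩
  rw [PDO.mcoeff_one, PsiDO.one]
  split_ifs
  · rw [Pi.one_apply, Matrix.map_one _ (map_zero _) (map_one _)]
  · rw [Pi.zero_apply, Matrix.map_zero _ (map_zero _)]

theorem RepresentsOp.pow {P : ℤ → OddTimes 𝕜 → Matrix ι ι 𝕂}
    {M : Matrix ι ι (PDO (partialDeriv hΩ hA 0))} (hP : RepresentsOp hΩ hA P M) (k : ℕ) :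
    RepresentsOp hΩ hA (PsiDO.pow (pd 0) P k) (M ^ k) := by
  induction k with
  | zero => rw [pow_zero]; exact RepresentsOp.one
  | succ k ih => rw [pow_succ']; exact hP.mul ih

theorem RepresentsOp.nonneg {P : ℤ → OddTimes 𝕜 → Matrix ι ι 𝕂}
    {M : Matrix ι ι (PDO (partialDeriv hΩ hA 0))} (hP : RepresentsOp hΩ hA P M) :
    RepresentsOp hΩ hA (PsiDO.nonneg P) (PDO.mnonneg M) := by
  obtain ⟨⟨p, hp⟩, hP⟩ := hP
  refine ⟨⟨p, fun i hi => by simp [PsiDO.nonneg, hp i hi]⟩, fun n t => ?_⟩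
  rw [PDO.mcoeff_mnonneg, PsiDO.nonneg]
  split_ifs
  · exact hP n t
  · rw [Pi.zero_apply, Matrix.map_zero _ (map_zero _)]

theorem RepresentsOp.adjoint {P : ℤ → OddTimes 𝕜 → Matrix ι ι 𝕂}
    {M : Matrix ι ι (PDO (partialDeriv hΩ hA 0))} (hP : RepresentsOp hΩ hA P M) :
    RepresentsOp hΩ hA (PsiDO.adjoint (pd 0) (fun f t => (f t)ᵀ) P) (PDO.madj M) := by
  obtain ⟨⟨p, hp⟩, hP⟩ := hP
  have hτ : (fun (f : OddTimes 𝕜 → Matrix ι ι 𝕂) t => (f t)ᵀ) 0 = 0 := by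
    funext t; exact Matrix.transpose_zero
  refine ⟨⟨_, hp.adjoint (pd_zero 0) hτ⟩, fun n t => ?_⟩
  obtain ⟨p', hp'⟩ := PDO.exists_morderLE M
  have hM : max p p' < n + ((max p p' - n).toNat + 1 : ℕ) := by push_cast; omega
  rw [PsiDO.adjoint_eq_sum (pd_zero 0) hτ (hp.mono (le_max_left p p')) n hM]
  ext i j
  simp only [PDO.mcoeff, PDO.madj, Matrix.map_apply, Matrix.transpose_apply]
  rw [PDO.coeff_adj_eq_sum ((hp'.mono (le_max_right p p')).entry j i) n hM, map_sum,
    Finset.sum_apply, Matrix.sum_apply]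
  refine Finset.sum_congr rfl fun k _ => ?_
  have h1 : Represents (fun t => (P (n + k) t)ᵀ) (PDO.mcoeff (n + k) M)ᵀ := fun t => by
    change (P (n + k) t.1)ᵀ = _
    rw [hP (n + k) t]; rfl
  have h2 := h1.iterate_pd (hΩ := hΩ) (hA := hA) 0 k t
  simp only [Pi.smul_apply, Matrix.smul_apply, h2, map_zsmul]
  rfl

end Operators

end OddTimes

theorem riccatiRHS_map {K K' n : Type*} [CommRing K] [CommRing K'] [Fintype n] [DecidableEq n]
    (f : K →+* K') (H : Matrix (n ⊕ n) (n ⊕ n) K) (Φ : Matrix n n K) :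
    (riccatiRHS H Φ).map f = riccatiRHS (H.map f) (Φ.map f) := by
  have h1 : H.toBlocks₁₁.map f = (H.map f).toBlocks₁₁ := rfl
  have h2 : H.toBlocks₁₂.map f = (H.map f).toBlocks₁₂ := rfl
  have h3 : H.toBlocks₂₁.map f = (H.map f).toBlocks₂₁ := rfl
  have h4 : H.toBlocks₂₂.map f = (H.map f).toBlocks₂₂ := rfl
  rw [riccatiRHS, riccatiRHS, ← h1, ← h2, ← h3, ← h4,
    Matrix.map_sub _ (map_sub f), Matrix.map_sub _ (map_sub f), Matrix.map_add _ (map_add f),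
    Matrix.map_mul, Matrix.map_mul, Matrix.map_mul, Matrix.map_mul]

theorem riccatiLeft_map {K K' n : Type*} [CommRing K] [CommRing K'] [Fintype n] [DecidableEq n]
    (f : K →+* K') (H : Matrix (n ⊕ n) (n ⊕ n) K) (Φ : Matrix n n K) :
    (riccatiLeft H Φ).map f = riccatiLeft (H.map f) (Φ.map f) := by
  have h2 : H.toBlocks₁₂.map f = (H.map f).toBlocks₁₂ := rfl
  have h4 : H.toBlocks₂₂.map f = (H.map f).toBlocks₂₂ := rfl
  rw [riccatiLeft, riccatiLeft, ← h2, ← h4, Matrix.map_sub _ (map_sub f), Matrix.map_mul]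

theorem riccatiRight_map {K K' n : Type*} [CommRing K] [CommRing K'] [Fintype n] [DecidableEq n]
    (f : K →+* K') (H : Matrix (n ⊕ n) (n ⊕ n) K) (Φ : Matrix n n K) :
    (riccatiRight H Φ).map f = riccatiRight (H.map f) (Φ.map f) := by
  have h1 : H.toBlocks₁₁.map f = (H.map f).toBlocks₁₁ := rfl
  have h2 : H.toBlocks₁₂.map f = (H.map f).toBlocks₁₂ := rfl
  rw [riccatiRight, riccatiRight, ← h1, ← h2, Matrix.map_add _ (map_add f), Matrix.map_mul]

theorem matrix_map_pow {K K' n : Type*} [CommRing K] [CommRing K'] [Fintype n] [DecidableEq n]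
    (f : K →+* K') (M : Matrix n n K) (k : ℕ) : (M ^ k).map f = M.map f ^ k :=
  map_pow f.mapMatrix M k

namespace OddTimes

variable {𝕜 𝕂 : Type*} [RCLike 𝕜] [RCLike 𝕂] [NormedAlgebra 𝕜 𝕂] {Ω : Set (OddTimes 𝕜)}

section Constants

variable {ι κ : Type*} {A : Subalgebra 𝕂 (Ω → 𝕂)}

theorem map_algebraMap_derivation (M : Matrix ι κ 𝕂) (d : Derivation 𝕂 A A) :
    (M.map (algebraMap 𝕂 A)).map d = 0 := by
  ext1 i j
  simp [Derivation.map_algebraMap]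

theorem represents_mul_mul {l : Type*} [Fintype ι] [Fintype κ] {f : OddTimes 𝕜 → Matrix ι κ 𝕂}
    {X : Matrix ι κ A} (h : Represents f X) (B : Matrix l ι 𝕂) (C : Matrix κ l 𝕂) :
    Represents (fun t => B * f t * C)
      (B.map (algebraMap 𝕂 A) * X * C.map (algebraMap 𝕂 A)) := fun t => by
  change B * f t.1 * C = _
  have e := Matrix.map_mul (L := B.map (algebraMap 𝕂 A) * X) (M := C.map (algebraMap 𝕂 A))
    (f := (evalAt A t).toRingHom)
  rw [Matrix.map_mul (L := B.map (algebraMap 𝕂 A)) (M := X)] at e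
  rw [h t]
  exact e.symm

end Constants

section Generated

variable {N : ℕ} (Ω) (Φ : OddTimes 𝕜 → Matrix (Fin N) (Fin N) 𝕂)

/-- The algebra of functions on `Ω` generated by the entries of `Φ`. -/
def entryAlgebra : Subalgebra 𝕂 (Ω → 𝕂) :=
  Algebra.adjoin 𝕂 (Set.range fun (p : Fin N × Fin N) (t : Ω) => Φ t.1 p.1 p.2)

/-- The generic matrix over `entryAlgebra`. -/
def entryMatrix : Matrix (Fin N) (Fin N) (entryAlgebra Ω Φ) :=
  Matrix.of fun i j => ⟨fun t => Φ t.1 i j, Algebra.subset_adjoin ⟨(i, j), rfl⟩⟩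

variable {Ω Φ}

theorem represents_entryMatrix : Represents Φ (entryMatrix Ω Φ) := fun _ => rfl

theorem isSmooth_of_mem (hΩ : IsDomain Ω) (hΦ : SmoothOn Ω Φ) {f : Ω → 𝕂}
    (hf : f ∈ entryAlgebra Ω Φ) : IsSmooth f := by
  induction hf using Algebra.adjoin_induction with
  | mem x hx =>
    obtain ⟨p, rfl⟩ := hx
    intro t ht n
    refine (hΦ t ht n p.1 p.2).congr_of_eventuallyEq ?_
    filter_upwards [hΩ.eventually_first ht n] with s hs
    rw [extendZero_of_mem _ hs]
  | algebraMap r => exact isSmooth_const hΩ r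
  | add x y _ _ hx hy => exact hx.add hy
  | mul x y _ _ hx hy => exact hx.mul hy

variable {H : Matrix (Fin N ⊕ Fin N) (Fin N ⊕ Fin N) 𝕂}

theorem hasPartialDeriv_entry (hΩ : IsDomain Ω) (hΦ : SmoothOn Ω Φ)
    (hric : ∀ k, ∀ t ∈ Ω, pd k Φ t = riccatiRHS (H ^ (2 * k + 1)) (Φ t)) (k : ℕ) (i j : Fin N) :
    HasPartialDeriv k (entryMatrix Ω Φ i j).1
      (riccatiRHS (H.map (algebraMap 𝕂 (entryAlgebra Ω Φ)) ^ (2 * k + 1)) (entryMatrix Ω Φ) i j).1 :=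
  fun t => by
    have h1 : HasDerivAt (fun s => Φ (Function.update t.1 k s) i j) _ (t.1 k) :=
      hΦ.hasPartialDerivAt t.2 k i j
    have h2 : pd k Φ t.1 i j = (riccatiRHS
        (H.map (algebraMap 𝕂 (entryAlgebra Ω Φ)) ^ (2 * k + 1)) (entryMatrix Ω Φ) i j).1 t := by
      have h3 := riccatiRHS_map (evalAt (entryAlgebra Ω Φ) t).toRingHom
        (H.map (algebraMap 𝕂 (entryAlgebra Ω Φ)) ^ (2 * k + 1)) (entryMatrix Ω Φ)
      rw [matrix_map_pow] at h3
      rw [hric k t.1 t.2]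
      exact (congrFun (congrFun h3 i) j).symm
    rw [h2] at h1
    refine h1.congr_of_eventuallyEq ?_
    filter_upwards [hΩ.eventually_line t.2 k] with s hs
    rw [extendZero_of_mem _ hs]; rfl

theorem isDiffClosed_entryAlgebra (hΩ : IsDomain Ω) (hΦ : SmoothOn Ω Φ)
    (hric : ∀ k, ∀ t ∈ Ω, pd k Φ t = riccatiRHS (H ^ (2 * k + 1)) (Φ t)) :
    IsDiffClosed (entryAlgebra Ω Φ) := by
  intro k f hf
  induction hf using Algebra.adjoin_induction with
  | mem x hx =>
    obtain ⟨p, rfl⟩ := hx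
    exact ⟨_, Subtype.prop _, hasPartialDeriv_entry hΩ hΦ hric k p.1 p.2⟩
  | algebraMap r => exact ⟨0, zero_mem _, hasPartialDeriv_const hΩ k r⟩
  | add x y _ _ hx hy =>
    obtain ⟨x', hx', hx⟩ := hx
    obtain ⟨y', hy', hy⟩ := hy
    exact ⟨_, add_mem hx' hy', hx.add hy⟩
  | mul x y hxm hym hx hy =>
    obtain ⟨x', hx', hx⟩ := hx
    obtain ⟨y', hy', hy⟩ := hy
    exact ⟨_, add_mem (mul_mem hx' hym) (mul_mem hxm hy'), hx.mul hy⟩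

theorem map_partialDeriv_entryMatrix (hΩ : IsDomain Ω) (hΦ : SmoothOn Ω Φ)
    (hric : ∀ k, ∀ t ∈ Ω, pd k Φ t = riccatiRHS (H ^ (2 * k + 1)) (Φ t))
    (hA : IsDiffClosed (entryAlgebra Ω Φ)) (k : ℕ) :
    (entryMatrix Ω Φ).map (partialDeriv hΩ hA k) =
      riccatiRHS (H.map (algebraMap 𝕂 (entryAlgebra Ω Φ)) ^ (2 * k + 1)) (entryMatrix Ω Φ) := by
  ext1 i j
  exact (hasPartialDeriv_entry hΩ hΦ hric k i j).partialDeriv_eq hΩ hA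

theorem partialDeriv_comm (hΩ : IsDomain Ω) (hΦ : SmoothOn Ω Φ)
    (hric : ∀ k, ∀ t ∈ Ω, pd k Φ t = riccatiRHS (H ^ (2 * k + 1)) (Φ t))
    (hA : IsDiffClosed (entryAlgebra Ω Φ)) (k l : ℕ) (f : entryAlgebra Ω Φ) :
    partialDeriv hΩ hA k (partialDeriv hΩ hA l f) =
      partialDeriv hΩ hA l (partialDeriv hΩ hA k f) := by
  obtain ⟨f, hf⟩ := f
  induction hf using Algebra.adjoin_induction with
  | mem x hx =>
    obtain ⟨p, rfl⟩ := hx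
    have := map_map_comm (map_algebraMap_derivation H (partialDeriv hΩ hA k))
      (map_algebraMap_derivation H (partialDeriv hΩ hA l))
      (map_partialDeriv_entryMatrix hΩ hΦ hric hA k)
      (map_partialDeriv_entryMatrix hΩ hΦ hric hA l)
    exact congrFun (congrFun this p.1) p.2
  | algebraMap r =>
    change partialDeriv hΩ hA k (partialDeriv hΩ hA l (algebraMap 𝕂 (entryAlgebra Ω Φ) r)) =
      partialDeriv hΩ hA l (partialDeriv hΩ hA k (algebraMap 𝕂 (entryAlgebra Ω Φ) r))
    simp only [Derivation.map_algebraMap, map_zero]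
  | add x y hxm hym hx hy =>
    change partialDeriv hΩ hA k (partialDeriv hΩ hA l (⟨x, hxm⟩ + ⟨y, hym⟩)) =
      partialDeriv hΩ hA l (partialDeriv hΩ hA k (⟨x, hxm⟩ + ⟨y, hym⟩))
    simp only [map_add, hx, hy]
  | mul x y hxm hym hx hy =>
    change partialDeriv hΩ hA k (partialDeriv hΩ hA l (⟨x, hxm⟩ * ⟨y, hym⟩)) =
      partialDeriv hΩ hA l (partialDeriv hΩ hA k (⟨x, hxm⟩ * ⟨y, hym⟩))
    simp only [map_add, Derivation.leibniz, smul_eq_mul, hx, hy]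
    ring

end Generated

section Skew

/-- An integral of skew-symmetric functions with skew-symmetric constants of integration is
skew-symmetric. -/
theorem transpose_eq_neg_of_hasSkewConstants {N : ℕ} (hΩ : IsDomain Ω)
    {J : OddTimes 𝕜 → Matrix (Fin N) (Fin N) 𝕂} (hJ : SmoothOn Ω J)
    (hpd : ∀ t ∈ Ω, (pd 0 J t)ᵀ = -pd 0 J t) (hskew : HasSkewConstants Ω J) {t : OddTimes 𝕜}
    (ht : t ∈ Ω) : (J t)ᵀ = -J t := by
  obtain ⟨s, hs, hJs⟩ := hskew t ht
  set U : Set 𝕜 := {s : 𝕜 | Function.update t 0 s ∈ Ω} with hU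
  have hUo : IsOpen U := hΩ.isOpen_line t 0
  have htU : t 0 ∈ U := by simpa [hU] using ht
  ext i j
  have hder : ∀ x ∈ U, HasDerivAt
      (fun s => J (Function.update t 0 s) j i + J (Function.update t 0 s) i j) 0 x := by
    intro x hx
    have hx' : Function.update t 0 x ∈ Ω := hx
    have h1 := hJ.hasPartialDerivAt hx' 0
    have h2 := (h1 j i).fun_add (h1 i j)
    have h3 := congrFun (congrFun (hpd _ hx') i) j
    simp only [Matrix.transpose_apply, Matrix.neg_apply] at h3
    rw [h3, neg_add_cancel] at h2
    simpa only [Function.update_idem, Function.update_self] using h2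
  have hsub := connectedComponentIn_subset U (t 0)
  have h := hUo.connectedComponentIn.is_const_of_deriv_eq_zero
    isPreconnected_connectedComponentIn
    (fun x hx => (hder x (hsub hx)).differentiableAt.differentiableWithinAt)
    (fun x hx => (hder x (hsub hx)).deriv) (mem_connectedComponentIn htU) hs
  have h4 := congrFun (congrFun hJs i) j
  simp only [Matrix.transpose_apply, Matrix.neg_apply] at h4 ⊢
  rw [h4, neg_add_cancel, Function.update_eq_self] at h
  exact eq_neg_of_add_eq_zero_left h

end Skew

end OddTimes

section Main

open OddTimes

variable {𝕜 𝕂 : Type*} [RCLike 𝕜] [RCLike 𝕂] [NormedAlgebra 𝕜 𝕂] {Ω : Set (OddTimes 𝕜)}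

/-- The function `u_k` extracted from a matrix of operators. -/
def laxCoeff {m : ℕ} {A : Subalgebra 𝕂 (Ω → 𝕂)} {δ : Derivation 𝕂 A A}
    (M : Matrix (Fin m) (Fin m) (PDO δ)) (k : ℕ) : OddTimes 𝕜 → Matrix (Fin m) (Fin m) 𝕂 :=
  fun t => Matrix.of fun i j => extendZero ((M i j).coeff (1 - k)).1 t

theorem represents_laxCoeff {m : ℕ} {A : Subalgebra 𝕂 (Ω → 𝕂)} {δ : Derivation 𝕂 A A}
    (M : Matrix (Fin m) (Fin m) (PDO δ)) (k : ℕ) :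
    Represents (laxCoeff M k) (PDO.mcoeff (1 - k) M) := fun t => by
  ext i j
  simp only [laxCoeff, Matrix.of_apply, extendZero_of_mem _ t.2]
  rfl

theorem representsOp_lax {m : ℕ} (hΩ : IsDomain Ω) {A : Subalgebra 𝕂 (Ω → 𝕂)}
    (hA : IsDiffClosed A) (M : Matrix (Fin m) (Fin m) (PDO (partialDeriv hΩ hA 0)))
    (hM : ∀ k : ℤ, 0 ≤ k → PDO.mcoeff k M = if k = 1 then 1 else 0) :
    RepresentsOp hΩ hA (PsiDO.lax (laxCoeff M)) M := by
  refine ⟨⟨1, fun i hi => ?_⟩, fun n => ?_⟩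
  · rw [PsiDO.lax, if_neg (by omega), if_neg (by omega)]
  · unfold PsiDO.lax
    by_cases h1 : n < 0
    · rw [if_neg (by omega), if_pos h1]
      have := represents_laxCoeff M (1 - n).toNat
      rwa [show 1 - ((1 - n).toNat : ℤ) = n by omega] at this
    · intro t
      rw [hM n (by omega)]
      split_ifs
      · rw [Pi.one_apply, Matrix.map_one _ (map_zero _) (map_one _)]
      · rw [Pi.zero_apply, Matrix.map_zero _ (map_zero _)]

theorem hasPartialDerivAt_riccatiTheta {N : ℕ} {R Q S L : Matrix (Fin N) (Fin N) 𝕂}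
    {Φ J : OddTimes 𝕜 → Matrix (Fin N) (Fin N) 𝕂} (hΦ : SmoothOn Ω Φ)
    (hJ : IsCommutatorIntegral Ω Q Φ J) {t : OddTimes 𝕜} (ht : t ∈ Ω) :
    HasPartialDerivAt 0 (riccatiTheta R L Φ J)
      ((1 / 2 : 𝕂) • (riccatiLeft (Matrix.fromBlocks R Q S L) (Φ t) * pd 0 Φ t +
        pd 0 Φ t * riccatiRight (Matrix.fromBlocks R Q S L) (Φ t))) t := by
  have h1 := hΦ.hasPartialDerivAt ht 0
  have h2 := hJ.1.hasPartialDerivAt ht 0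
  rw [hJ.2 t ht] at h2
  have h3 := (((h1.const_mul L).add (h1.mul_const R)).sub h2).smul (1 / 2 : 𝕂)
  have e : riccatiLeft (Matrix.fromBlocks R Q S L) (Φ t) * pd 0 Φ t +
      pd 0 Φ t * riccatiRight (Matrix.fromBlocks R Q S L) (Φ t) =
      L * pd 0 Φ t + pd 0 Φ t * R - (Φ t * Q * pd 0 Φ t - pd 0 Φ t * Q * Φ t) := by
    simp only [riccatiLeft, riccatiRight, Matrix.toBlocks_fromBlocks₁₁,
      Matrix.toBlocks_fromBlocks₁₂, Matrix.toBlocks_fromBlocks₂₂]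
    noncomm_ring
  rw [e]
  exact h3

end Main

end

theorem proposition5p2 {𝕜 𝕂 : Type*} [RCLike 𝕜] [RCLike 𝕂] [NormedAlgebra 𝕜 𝕂] {N m : ℕ}
    (Ω : Set (OddTimes 𝕜)) (hΩ : OddTimes.IsDomain Ω)
    (R Q S L : Matrix (Fin N) (Fin N) 𝕂) (V : Matrix (Fin N) (Fin m) 𝕂)
    (hR : R = -Lᵀ) (hS : S = Sᵀ) (hQ : Q = V * Vᵀ)
    (Φ : OddTimes 𝕜 → Matrix (Fin N) (Fin N) 𝕂) (hΦ : SolvesOddRiccati Ω R Q S L Φ)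
    (hsymm : ∀ t ∈ Ω, (Φ t)ᵀ = Φ t)
    (J : OddTimes 𝕜 → Matrix (Fin N) (Fin N) 𝕂) (hJ : IsCommutatorIntegral Ω Q Φ J)
    (hJskew : HasSkewConstants Ω J) :
    SolvesMatrixCKP Ω (fun t => Vᵀ * Φ t * V) (fun t => Vᵀ * riccatiTheta R L Φ J t * V) := by
  obtain ⟨hsm, hric⟩ := hΦ
  set H₀ := Matrix.fromBlocks R Q S L with hH₀
  replace hric : ∀ k, ∀ t ∈ Ω, OddTimes.pd k Φ t = riccatiRHS (H₀ ^ (2 * k + 1)) (Φ t) := hric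
  have hA := OddTimes.isDiffClosed_entryAlgebra hΩ hsm hric
  set A := OddTimes.entryAlgebra Ω Φ
  set X := OddTimes.entryMatrix Ω Φ
  set H := H₀.map (algebraMap 𝕂 A)
  set W := V.map (algebraMap 𝕂 A)
  set D := OddTimes.partialDeriv hΩ hA
  have hH (k) : H.map (D k) = 0 := OddTimes.map_algebraMap_derivation H₀ (D k)
  have hW (k) : W.map (D k) = 0 := OddTimes.map_algebraMap_derivation V (D k)
  have hHQ : H.toBlocks₁₂ = W * Wᵀ := by
    change Q.map (algebraMap 𝕂 A) = _
    rw [hQ, Matrix.map_mul, Matrix.transpose_map]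
  have hHR : H.toBlocks₁₁ = -H.toBlocks₂₂ᵀ := by
    change R.map (algebraMap 𝕂 A) = -(L.map (algebraMap 𝕂 A))ᵀ
    rw [hR]
    ext1 i j
    simp
  have hXD (k) : X.map (D k) = riccatiRHS (H ^ (2 * k + 1)) X :=
    OddTimes.map_partialDeriv_entryMatrix hΩ hsm hric hA k
  have hX : X.map (D 0) = riccatiRHS H X := by simpa using hXD 0
  have hXs : Xᵀ = X := by
    ext1 i j
    exact Subtype.ext (funext fun t => congrFun (congrFun (hsymm t.1 t.2) i) j)
  set M := PDO.dressedLax (D 0) H X W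
  have hM : OddTimes.RepresentsOp hΩ hA (PsiDO.lax (laxCoeff M)) M :=
    representsOp_lax hΩ hA M fun k hk =>
      PDO.mcoeff_dressedLax_of_nonneg (hH 0) (hW 0) hHQ hX hk
  have hφ : OddTimes.Represents (fun t => Vᵀ * Φ t * V) (Wᵀ * X * W) :=
    OddTimes.represents_mul_mul OddTimes.represents_entryMatrix Vᵀ V
  have hWt (k) : Wᵀ.map (D k) = 0 := by rw [Matrix.transpose_map, hW, Matrix.transpose_zero]
  have hφD (k) : (Wᵀ * X * W).map (D k) = Wᵀ * riccatiRHS (H ^ (2 * k + 1)) X * W := by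
    rw [PDO.map_derivation_mul, PDO.map_derivation_mul, hW, hWt, hXD]; simp
  have hφpd (k) : OddTimes.Represents (OddTimes.pd k fun t => Vᵀ * Φ t * V)
      (Wᵀ * riccatiRHS (H ^ (2 * k + 1)) X * W) := by
    rw [← hφD]; exact hφ.pd k
  have hθsm : OddTimes.SmoothOn Ω (riccatiTheta R L Φ J) :=
    (((hsm.const_mul L).add (hsm.mul_const R)).sub hJ.1).smul _
  have hQs : Qᵀ = Q := by rw [hQ]; simp
  have hpds : ∀ t ∈ Ω, (OddTimes.pd 0 Φ t)ᵀ = OddTimes.pd 0 Φ t := by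
    intro t ht
    rw [hric 0 t ht]
    simp only [mul_zero, zero_add, pow_one, riccatiRHS, hH₀, Matrix.toBlocks_fromBlocks₁₁,
      Matrix.toBlocks_fromBlocks₁₂, Matrix.toBlocks_fromBlocks₂₁, Matrix.toBlocks_fromBlocks₂₂,
      Matrix.transpose_add, Matrix.transpose_sub, Matrix.transpose_mul, hsymm t ht, ← hS, hQs, hR,
      Matrix.transpose_neg, Matrix.transpose_transpose]
    noncomm_ring
  have hJs : ∀ t ∈ Ω, (J t)ᵀ = -J t := fun t ht => by
    refine OddTimes.transpose_eq_neg_of_hasSkewConstants hΩ hJ.1 (fun t ht => ?_) hJskew ht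
    rw [hJ.2 t ht]
    simp only [Matrix.transpose_sub, Matrix.transpose_mul, hsymm t ht, hQs, hpds t ht]
    noncomm_ring
  refine ⟨⟨laxCoeff M, ⟨(hsm.const_mul _).mul_const _, (hθsm.const_mul _).mul_const _, ?_, ?_, ?_,
    ?_, ?_⟩, ?_⟩, ?_, ?_⟩
  · exact fun k _ t ht n i j => OddTimes.isSmooth_of_mem hΩ hsm (Subtype.prop _) t ht n
  · intro t ht
    have h := PDO.mcoeff_neg_one_dressedLax_pow (hH 0) (hW 0) hHQ hX 1
    rw [pow_one, pow_one] at h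
    rw [represents_laxCoeff M 2 ⟨t, ht⟩, hφpd 0 ⟨t, ht⟩]
    simp only [mul_zero, zero_add, pow_one, ← h]
    rfl
  · intro t ht
    have hθ := (((hasPartialDerivAt_riccatiTheta (R := R) (S := S) (L := L) hsm hJ
      ht).const_mul Vᵀ).mul_const V).pd_eq
    have hφ2 := ((hφpd 0).pd (hΩ := hΩ) (hA := hA) 0) ⟨t, ht⟩
    let e : A →+* 𝕂 := (OddTimes.evalAt A ⟨t, ht⟩).toRingHom
    have hF : (riccatiRHS H X).map e = OddTimes.pd 0 Φ t := by
      rw [riccatiRHS_map, hric 0 t ht, mul_zero, zero_add, pow_one]; rfl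
    have hl : (riccatiLeft H X).map e = riccatiLeft H₀ (Φ t) := riccatiLeft_map e H X
    have hr : (riccatiRight H X).map e = riccatiRight H₀ (Φ t) := riccatiRight_map e H X
    have hWe : W.map e = V := rfl
    have hWte : Wᵀ.map e = Vᵀ := rfl
    replace hφ2 : OddTimes.pd 0 (OddTimes.pd 0 fun t => Vᵀ * Φ t * V) t =
        ((Wᵀ * riccatiRHS (H ^ (2 * 0 + 1)) X * W).map (D 0)).map e := hφ2
    rw [mul_zero, zero_add, pow_one, PDO.map_derivation_mul, PDO.map_derivation_mul, hW, hWt,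
      map_riccatiRHS (hH 0), hX, Matrix.zero_mul, zero_add, Matrix.mul_zero, add_zero,
      Matrix.map_mul, Matrix.map_mul, Matrix.map_sub _ (map_sub e), Matrix.map_mul, Matrix.map_mul,
      hF, hl, hr, hWe, hWte] at hφ2
    have hu : laxCoeff M 3 t = (PDO.mcoeff (-2) M).map e := represents_laxCoeff M 3 ⟨t, ht⟩
    rw [hu, PDO.mcoeff_neg_two_dressedLax (hH 0) (hW 0) hHQ hX, Matrix.map_mul, Matrix.map_mul,
      Matrix.map_mul, hF, hr, hWe, hWte, hθ, hφ2]
    simp only [Matrix.mul_smul, Matrix.smul_mul, ← smul_sub, ← Matrix.mul_sub, ← Matrix.sub_mul]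
    rw [add_sub_sub_cancel, ← two_smul 𝕂 (OddTimes.pd 0 Φ t * _), Matrix.mul_smul,
      Matrix.smul_mul, smul_smul, ← hH₀]
    norm_num
  · intro k i t ht
    have h1 := (hM.2 i).pd (hΩ := hΩ) (hA := hA) k ⟨t, ht⟩
    have h2 := (((hM.pow (2 * k + 1)).nonneg.mul hM).sub
      (hM.mul (hM.pow (2 * k + 1)).nonneg)).2 i ⟨t, ht⟩
    rw [← PDO.mevol_dressedLax (OddTimes.partialDeriv_comm hΩ hsm hric hA k 0) (hH 0) (hW 0) hHQ hX
      (hH k) (hW k) (hXD k)] at h2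
    exact h1.trans h2.symm
  · intro k t ht
    rw [hφpd k ⟨t, ht⟩, (hM.pow (2 * k + 1)).2 (-1) ⟨t, ht⟩,
      PDO.mcoeff_neg_one_dressedLax_pow (hH 0) (hW 0) hHQ hX]
  · intro i t ht
    rw [hM.2 i ⟨t, ht⟩, hM.adjoint.2 i ⟨t, ht⟩,
      PDO.madj_dressedLax (hH 0) (hW 0) hHQ hHR hX hXs, PDO.mcoeff_neg]
    ext a b
    simp [M]
  · intro t ht
    simp [Matrix.transpose_mul, hsymm t ht, Matrix.mul_assoc]
  · intro t ht
    simp only [riccatiTheta, Matrix.transpose_mul, Matrix.transpose_smul, Matrix.transpose_sub,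
      Matrix.transpose_add, Matrix.transpose_transpose, hsymm t ht, hJs t ht, hR,
      Matrix.transpose_neg, Matrix.mul_smul, Matrix.smul_mul, Matrix.mul_add, Matrix.mul_sub,
      Matrix.add_mul, Matrix.sub_mul, Matrix.mul_neg, Matrix.neg_mul, Matrix.mul_assoc]
    rw [← smul_neg]
    congr 1
    abel
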